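/- Let $\mathbb H$ be the upper half plane, $q=e^{2\pi i\tau}$. Let $W(D_4)\subset W(F_4)$ be the Weyl groups acting on $\mathbb C^4$, where $D_4$ has the roots $\pm\epsilon_i\pm\epsilon_j$ $(i\neq j)$ and $F_4$ has in addition the roots $\pm\epsilon_i$ and $\frac12(\pm1,\pm1,\pm1,\pm1)$. Both $SL_2(\mathbb Z)/\Gamma(2)$ and $W(F_4)/W(D_4)$ are isomorphic to $S_3$; identify them so that the class of $\left(\begin{smallmatrix}1&1\\0&1\end{smallmatrix}\right)$ corresponds to that of $z_4\mapsto -z_4$ and the class of $\left(\begin{smallmatrix}0&-1\\1&0\end{smallmatrix}\right)$ to that of $$\tfrac12\left(\begin{smallmatrix}1&1&1&-1\\1&1&-1&1\\1&-1&1&1\\-1&1&1&1\end{smallmatrix}\right),$$ and let $\mathcal G=SL_2(\mathbb Z)\times_{S_3}W(F_4)$ be the fibre product. A $D_4$ triality invariant of weight $k\in\mathbb Z$ and degree $m\in\mathbb Z_{\ge0}$ is a holomorphic function $\varphi:\mathbb H\times\mathbb C^4\to\mathbb C$ such that: (i) $\varphi(\tau,z_1,\dots,z_4)$ is a homogeneous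 polynomial of degree $m$ in $z_1,\dots,z_4$; (ii) $\varphi\left(\frac{a\tau+b}{c\tau+d},w(z)\right)=(c\tau+d)^k\varphi(\tau,z)$ for all $\left(\left(\begin{smallmatrix}a&b\\c&d\end{smallmatrix}\right),w\right)\in\mathcal G$; (iii) for all $z_1,z_2,z_3\in\mathbb C$ and $\Lambda\in\mathbb C^*$, the limit $\lim_{q\to0}|\varphi(\tau,z_1,z_2,z_3,q^{-1/2}\Lambda)|$ exists and is finite (with $q^{-1/2}=e^{-\pi i\tau}$). Let $R_{*,*}$ be the ring of finite sums of $D_4$ triality invariants of arbitrary weights and degrees. Let $M_*$ be the ring of modular forms on $SL_2(\mathbb Z)$ and $\Delta=\eta^{24}$. Put $$\vartheta_2=\sum_{n\in\mathbb Z}q^{(n-1/2)^2/2},\quad \vartheta_3=\sum_{n\in\mathbb Z}q^{n^2/2},\quad \vartheta_4=\sum_{n\in\mathbb Z}(-1)^nq^{n^2/2},$$ $$e_1=\tfrac1{12}(\vartheta_3^4+\vartheta_4^4),\quad e_2=\tfrac1{12}(\vartheta_2^4-\vartheta_4^4),\quad e_3=\tfrac1{12}(-\vartheta_2^4-\vartheta_3^4),$$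 $$I_2=\sum_i z_i^2,\quad I_4=\sum_{i<j}z_i^2z_j^2,\quad I_6=\sum_{i<j<k}z_i^2z_j^2z_k^2,\quad \tilde I_4=z_1z_2z_3z_4,$$ $$T_1=\tfrac16I_4-\tfrac1{24}I_2^2,\quad T_2=-\tfrac1{12}I_4-\tfrac12\tilde I_4+\tfrac1{48}I_2^2,\quad T_3=-\tfrac1{12}I_4+\tfrac12\tilde I_4+\tfrac1{48}I_2^2,$$ $$K=I_2,\quad L=\sum_{i=1}^3e_iT_i,\quad M=12\sum_{i=1}^3e_i^2T_i,\quad N=\tfrac14I_6-\tfrac1{24}I_2I_4+\tfrac1{96}I_2^3.$$ Then $K,L,M,N$ are algebraically independent over $M_*[\Delta^{-1}]$, and $R_{*,*}$ is contained in the polynomial ring that they generate over it: $$R_{*,*}\subset M_*[\Delta^{-1}][K,L,M,N].$$ -/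

import Mathlib

open Complex UpperHalfPlane Filter Topology
open scoped MatrixGroups Matrix Pointwise

noncomputable section

namespace D4Triality

/-- The space `ℂ⁴` of the variables `z = (z₁, z₂, z₃, z₄)`. -/
abbrev V : Type := Fin 4 → ℂ

/-- Functions on `ℍ × ℂ⁴`. -/
abbrev Fun : Type := ℍ × V → ℂ

/-! ### The Weyl groups of type `D₄` and `F₄`, and triality -/

/-- The minimal vectors of the four classes of `Λ* / Λ ≅ (ℤ/2)²`, where `Λ` is the `D₄` root
lattice and `Λ*` its weight lattice: the zero vector in the class `(0,0)`, and the weights of the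
three eight-dimensional representations, attached to the three legs of the Dynkin diagram, in the
other classes (vector: `(1,0)`, odd half-spin: `(0,1)`, even half-spin: `(1,1)`). -/
def minimalWeights (x : Fin 2 → ZMod 2) : Set V :=
  if x = 0 then {0}
  else if x = ![1, 0] then {z | ∃ i : Fin 4, z = Pi.single i 1 ∨ z = Pi.single i (-1)}
  else if x = ![0, 1] then {z | (∀ i, z i = 1 / 2 ∨ z i = -1 / 2) ∧ ∏ i, z i = -1 / 16}
  else {z | (∀ i, z i = 1 / 2 ∨ z i = -1 / 2) ∧ ∏ i, z i = 1 / 16}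

/-- The roots `± e_i ± e_j`, `i ≠ j`, of `D₄`. -/
def rootsD4 : Set V :=
  {α | ∃ i j : Fin 4, i ≠ j ∧ ∃ s t : ℂ, (s = 1 ∨ s = -1) ∧ (t = 1 ∨ t = -1) ∧
    α = Pi.single i s + Pi.single j t}

/-- The roots of `F₄`: the roots of `D₄`, the vectors `± e_i`, and the vectors
`(± 1 ± 1 ± 1 ± 1) / 2`. -/
def rootsF4 : Set V :=
  rootsD4 ∪ {z | ∃ i : Fin 4, z = Pi.single i 1 ∨ z = Pi.single i (-1)} ∪
    {z | ∀ i, z i = 1 / 2 ∨ z i = -1 / 2}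

/-- The group generated by the reflections `z ↦ z - 2 (α · z) / (α · α) α` in the vectors `α`
of a set of (real, nonzero) vectors, acting on `ℂ⁴`. -/
def reflectionGroup (roots : Set V) : Subgroup (V ≃ₗ[ℂ] V) :=
  Subgroup.closure {s | ∃ α ∈ roots, ∀ z : V, s z = z - (2 * (α ⬝ᵥ z) / (α ⬝ᵥ α)) • α}

/-- The Weyl group `W(D₄)`. -/
def weylD4 : Subgroup (V ≃ₗ[ℂ] V) := reflectionGroup rootsD4

/-- The Weyl group `W(F₄)`. -/
def weylF4 : Subgroup (V ≃ₗ[ℂ] V) := reflectionGroup rootsF4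

/-- Reduction `SL₂(ℤ) → SL₂(ℤ/2) = SL₂(ℤ) / Γ(2)`; the target is the symmetric group of the three
nonzero vectors of `(ℤ/2)²`. -/
def reduceModTwo : SL(2, ℤ) →* SL(2, ZMod 2) :=
  Matrix.SpecialLinearGroup.map (Int.castRingHom (ZMod 2))

/-- The fibre product `SL₂(ℤ) ×_{S₃} W(F₄)`, where `S₃` is the symmetric group of the three nonzero
classes of `Λ* / Λ ≅ (ℤ/2)²`: `SL₂(ℤ)` maps to it through `SL₂(ℤ) / Γ(2) = SL₂(ℤ/2)`, and `W(F₄)`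
maps to it, with kernel `W(D₄)`, by permuting the three sets of minimal weights. -/
def trialityGroup : Subgroup (SL(2, ℤ) × (V ≃ₗ[ℂ] V)) where
  carrier := {p | p.2 ∈ weylF4 ∧ ∀ x : Fin 2 → ZMod 2,
    (fun z => p.2 z) '' minimalWeights x = minimalWeights ((reduceModTwo p.1).1 *ᵥ x)}
  one_mem' := by
    refine ⟨weylF4.one_mem, fun x => ?_⟩
    simp
  mul_mem' := by
    rintro ⟨g, w⟩ ⟨g', w'⟩ ⟨h1, h2⟩ ⟨h1', h2'⟩
    refine ⟨weylF4.mul_mem h1 h1', fun x => ?_⟩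
    have := h2 ((reduceModTwo g').1 *ᵥ x)
    simp only [← h2', Set.image_image] at this
    rw [Matrix.mulVec_mulVec, ← Matrix.SpecialLinearGroup.coe_mul, ← map_mul] at this
    exact this
  inv_mem' := by
    rintro ⟨g, w⟩ ⟨h1, h2⟩
    refine ⟨weylF4.inv_mem h1, fun x => ?_⟩
    have := h2 ((reduceModTwo g⁻¹).1 *ᵥ x)
    rw [Matrix.mulVec_mulVec, ← Matrix.SpecialLinearGroup.coe_mul, ← map_mul] at this
    simp only [mul_inv_cancel, map_one, Matrix.SpecialLinearGroup.coe_one,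
      Matrix.one_mulVec] at this
    change (fun z => w⁻¹ z) '' minimalWeights x = minimalWeights ((reduceModTwo g⁻¹).1 *ᵥ x)
    rw [← this, Set.image_image]
    have hw : ∀ z, w⁻¹ (w z) = z := fun z => LinearEquiv.symm_apply_apply w z
    simp [hw]

/-- An element of `W(F₄)` of order two that permutes the three sets of minimal weights like `g`
lies over `g` in the fibre product. -/
theorem mem_trialityGroup_of_mapsTo {g : SL(2, ℤ)} {w : V ≃ₗ[ℂ] V} (hw : w ∈ weylF4)
    (hw2 : ∀ z, w (w z) = z)
    (h : ∀ x : Fin 2 → ZMod 2, ∀ z ∈ minimalWeights x,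
      w z ∈ minimalWeights ((reduceModTwo g).1 *ᵥ x))
    (hg : ∀ x : Fin 2 → ZMod 2, (reduceModTwo g).1 *ᵥ ((reduceModTwo g).1 *ᵥ x) = x) :
    (g, w) ∈ trialityGroup := by
  refine ⟨hw, fun x => Set.Subset.antisymm ?_ ?_⟩
  · rintro _ ⟨z, hz, rfl⟩
    exact h x z hz
  · intro z hz
    have h' := h _ z hz
    rw [hg] at h'
    exact ⟨w z, h', hw2 z⟩

/-- The generator `τ ↦ τ + 1`, `z₄ ↦ -z₄` of the triality. -/
def wT : V ≃ₗ[ℂ] V :=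
  LinearEquiv.ofInvolutive (Matrix.toLin' !![1, 0, 0, 0; 0, 1, 0, 0; 0, 0, 1, 0; 0, 0, 0, -1])
    (fun z => by ext i; fin_cases i <;> simp [Matrix.mulVec, dotProduct, Fin.sum_univ_four])

/-- The linear part of the generator of the triality over `τ ↦ -1 / τ`. -/
def wS : V ≃ₗ[ℂ] V :=
  LinearEquiv.ofInvolutive (Matrix.toLin' ((1 / 2 : ℂ) •
      !![1, 1, 1, -1; 1, 1, -1, 1; 1, -1, 1, 1; -1, 1, 1, 1]))
    (fun z => by
      ext i; fin_cases i <;> simp [Matrix.mulVec, dotProduct, Fin.sum_univ_four] <;> ring)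

theorem wT_apply (z : V) : wT z = ![z 0, z 1, z 2, -z 3] := by
  change Matrix.toLin' !![1, 0, 0, 0; 0, 1, 0, 0; 0, 0, 1, 0; 0, 0, 0, -1] z = _
  ext i; fin_cases i <;> simp [Matrix.mulVec, dotProduct, Fin.sum_univ_four]

theorem wS_apply (z : V) : wS z = ![(z 0 + z 1 + z 2 - z 3) / 2, (z 0 + z 1 - z 2 + z 3) / 2,
    (z 0 - z 1 + z 2 + z 3) / 2, (-z 0 + z 1 + z 2 + z 3) / 2] := by
  change Matrix.toLin' ((1 / 2 : ℂ) • !![1, 1, 1, -1; 1, 1, -1, 1; 1, -1, 1, 1; -1, 1, 1, 1]) z = _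
  ext i; fin_cases i <;> simp [Matrix.mulVec, dotProduct, Fin.sum_univ_four] <;> ring

theorem forall_zmod2 (P : (Fin 2 → ZMod 2) → Prop) :
    (∀ x, P x) ↔ P ![0, 0] ∧ P ![1, 0] ∧ P ![0, 1] ∧ P ![1, 1] := by
  refine ⟨fun h => ⟨h _, h _, h _, h _⟩, fun ⟨h1, h2, h3, h4⟩ x => ?_⟩
  have hx : x = ![0, 0] ∨ x = ![1, 0] ∨ x = ![0, 1] ∨ x = ![1, 1] := by
    revert x; decide
  rcases hx with rfl | rfl | rfl | rfl <;> assumption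

theorem minimalWeights_00 : minimalWeights ![0, 0] = {0} := by
  have : (![0, 0] : Fin 2 → ZMod 2) = 0 := by decide
  simp [minimalWeights, this]

theorem minimalWeights_10 : minimalWeights ![1, 0] =
    {z | ∃ i : Fin 4, z = Pi.single i 1 ∨ z = Pi.single i (-1)} := by
  have : (![1, 0] : Fin 2 → ZMod 2) ≠ 0 := by decide
  rw [minimalWeights, if_neg this, if_pos rfl]

theorem minimalWeights_01 : minimalWeights ![0, 1] =
    {z | (∀ i, z i = 1 / 2 ∨ z i = -1 / 2) ∧ ∏ i, z i = -1 / 16} := by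
  have h1 : (![0, 1] : Fin 2 → ZMod 2) ≠ 0 := by decide
  have h2 : (![0, 1] : Fin 2 → ZMod 2) ≠ ![1, 0] := by decide
  rw [minimalWeights, if_neg h1, if_neg h2, if_pos rfl]

theorem minimalWeights_11 : minimalWeights ![1, 1] =
    {z | (∀ i, z i = 1 / 2 ∨ z i = -1 / 2) ∧ ∏ i, z i = 1 / 16} := by
  have h1 : (![1, 1] : Fin 2 → ZMod 2) ≠ 0 := by decide
  have h2 : (![1, 1] : Fin 2 → ZMod 2) ≠ ![1, 0] := by decide
  have h3 : (![1, 1] : Fin 2 → ZMod 2) ≠ ![0, 1] := by decide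
  rw [minimalWeights, if_neg h1, if_neg h2, if_neg h3]

theorem T_mem_trialityGroup : (ModularGroup.T, wT) ∈ trialityGroup := by
  have hT : (reduceModTwo ModularGroup.T).1 = !![1, 1; 0, 1] := by decide
  apply mem_trialityGroup_of_mapsTo
  · refine Subgroup.subset_closure ⟨Pi.single 3 1, Or.inl (Or.inr ⟨3, Or.inl rfl⟩), fun z => ?_⟩
    rw [wT_apply]
    ext i; fin_cases i <;> simp [dotProduct, Fin.sum_univ_four] ; ring
  · intro z; simp only [wT_apply]; ext i; fin_cases i <;> simp
  · rw [forall_zmod2, hT]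
    have a0 : (!![1, 1; 0, 1] : Matrix (Fin 2) (Fin 2) (ZMod 2)) *ᵥ ![0, 0] = ![0, 0] := by decide
    have a1 : (!![1, 1; 0, 1] : Matrix (Fin 2) (Fin 2) (ZMod 2)) *ᵥ ![1, 0] = ![1, 0] := by decide
    have a2 : (!![1, 1; 0, 1] : Matrix (Fin 2) (Fin 2) (ZMod 2)) *ᵥ ![0, 1] = ![1, 1] := by decide
    have a3 : (!![1, 1; 0, 1] : Matrix (Fin 2) (Fin 2) (ZMod 2)) *ᵥ ![1, 1] = ![0, 1] := by decide
    rw [a0, a1, a2, a3, minimalWeights_00, minimalWeights_10, minimalWeights_01, minimalWeights_11]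
    refine ⟨?_, ?_, ?_, ?_⟩
    · simp
    · rintro z ⟨i, rfl | rfl⟩
      · fin_cases i
        · exact ⟨0, Or.inl (by rw [wT_apply]; ext i; fin_cases i <;> simp)⟩
        · exact ⟨1, Or.inl (by rw [wT_apply]; ext i; fin_cases i <;> simp)⟩
        · exact ⟨2, Or.inl (by rw [wT_apply]; ext i; fin_cases i <;> simp)⟩
        · exact ⟨3, Or.inr (by rw [wT_apply]; ext i; fin_cases i <;> simp)⟩
      · fin_cases i
        · exact ⟨0, Or.inr (by rw [wT_apply]; ext i; fin_cases i <;> simp)⟩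
        · exact ⟨1, Or.inr (by rw [wT_apply]; ext i; fin_cases i <;> simp)⟩
        · exact ⟨2, Or.inr (by rw [wT_apply]; ext i; fin_cases i <;> simp)⟩
        · exact ⟨3, Or.inl (by rw [wT_apply]; ext i; fin_cases i <;> simp)⟩
    all_goals
      rintro z ⟨hz, hz'⟩
      rw [Fin.prod_univ_four] at hz'
      refine ⟨fun i => ?_, ?_⟩
      · rw [wT_apply]
        fin_cases i
        · exact hz 0
        · exact hz 1
        · exact hz 2
        · rcases hz 3 with h | h
          · right; simp [h]; norm_num
          · left; simp [h]; norm_num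
      · rw [wT_apply, Fin.prod_univ_four]
        simp
        linear_combination -hz'
  · rw [hT]; decide

theorem S_mem_trialityGroup : (ModularGroup.S, wS) ∈ trialityGroup := by
  have hS : (reduceModTwo ModularGroup.S).1 = !![0, 1; 1, 0] := by decide
  apply mem_trialityGroup_of_mapsTo
  · refine Subgroup.subset_closure ⟨![1 / 2, -1 / 2, -1 / 2, 1 / 2], Or.inr ?_, fun z => ?_⟩
    · intro i; fin_cases i <;> simp
    rw [wS_apply]
    ext i; fin_cases i <;> simp [dotProduct, Fin.sum_univ_four] <;> ring
  · intro z; simp only [wS_apply]; ext i; fin_cases i <;> simp <;> ring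
  · rw [forall_zmod2, hS]
    have a0 : (!![0, 1; 1, 0] : Matrix (Fin 2) (Fin 2) (ZMod 2)) *ᵥ ![0, 0] = ![0, 0] := by decide
    have a1 : (!![0, 1; 1, 0] : Matrix (Fin 2) (Fin 2) (ZMod 2)) *ᵥ ![1, 0] = ![0, 1] := by decide
    have a2 : (!![0, 1; 1, 0] : Matrix (Fin 2) (Fin 2) (ZMod 2)) *ᵥ ![0, 1] = ![1, 0] := by decide
    have a3 : (!![0, 1; 1, 0] : Matrix (Fin 2) (Fin 2) (ZMod 2)) *ᵥ ![1, 1] = ![1, 1] := by decide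
    rw [a0, a1, a2, a3, minimalWeights_00, minimalWeights_10, minimalWeights_01, minimalWeights_11]
    refine ⟨?_, ?_, ?_, ?_⟩
    · simp
    · rintro z ⟨i, rfl | rfl⟩ <;> rw [wS_apply] <;> fin_cases i <;>
        refine ⟨fun j => ?_, ?_⟩ <;> (try fin_cases j) <;> simp [Fin.prod_univ_four] <;> norm_num
    · rintro z ⟨hz, hz'⟩
      rw [Fin.prod_univ_four] at hz'
      rw [wS_apply]
      rcases hz 0 with h0 | h0 <;> rcases hz 1 with h1 | h1 <;> rcases hz 2 with h2 | h2 <;>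
        rcases hz 3 with h3 | h3 <;> rw [h0, h1, h2, h3] at hz' ⊢ <;>
        first
          | (exfalso; norm_num at hz'; done)
          | (refine ⟨0, Or.inl ?_⟩; ext j; fin_cases j <;> norm_num [Pi.single_apply, Fin.ext_iff]; done)
          | (refine ⟨0, Or.inr ?_⟩; ext j; fin_cases j <;> norm_num [Pi.single_apply, Fin.ext_iff]; done)
          | (refine ⟨1, Or.inl ?_⟩; ext j; fin_cases j <;> norm_num [Pi.single_apply, Fin.ext_iff]; done)
          | (refine ⟨1, Or.inr ?_⟩; ext j; fin_cases j <;> norm_num [Pi.single_apply, Fin.ext_iff]; done)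
          | (refine ⟨2, Or.inl ?_⟩; ext j; fin_cases j <;> norm_num [Pi.single_apply, Fin.ext_iff]; done)
          | (refine ⟨2, Or.inr ?_⟩; ext j; fin_cases j <;> norm_num [Pi.single_apply, Fin.ext_iff]; done)
          | (refine ⟨3, Or.inl ?_⟩; ext j; fin_cases j <;> norm_num [Pi.single_apply, Fin.ext_iff]; done)
          | (refine ⟨3, Or.inr ?_⟩; ext j; fin_cases j <;> norm_num [Pi.single_apply, Fin.ext_iff])
    · rintro z ⟨hz, hz'⟩
      rw [Fin.prod_univ_four] at hz'
      rw [wS_apply]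
      rcases hz 0 with h0 | h0 <;> rcases hz 1 with h1 | h1 <;> rcases hz 2 with h2 | h2 <;>
        rcases hz 3 with h3 | h3 <;> rw [h0, h1, h2, h3] at hz' ⊢ <;>
        first
          | (exfalso; norm_num at hz'; done)
          | (refine ⟨fun j => ?_, ?_⟩ <;> [fin_cases j; rw [Fin.prod_univ_four]] <;> simp <;> norm_num)
  · rw [hS]; decide

/-! ### Triality invariants -/

/-- `φ : ℍ × ℂ⁴ → ℂ` is a `D₄` triality invariant of weight `k` and degree `m`. -/
structure IsTrialityInvariant (k : ℤ) (m : ℕ) (φ : Fun) : Prop where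
  /-- `φ` is holomorphic on `ℍ × ℂ⁴`. -/
  holomorphic : DifferentiableOn ℂ (fun p : ℂ × V => φ (ofComplex p.1, p.2))
    ({τ : ℂ | 0 < τ.im} ×ˢ Set.univ)
  /-- `φ` is a homogeneous polynomial of degree `m` in `z₁, z₂, z₃, z₄`. -/
  homogeneous : ∀ τ : ℍ, ∃ P : MvPolynomial (Fin 4) ℂ, P.IsHomogeneous m ∧
    ∀ z : V, φ (τ, z) = MvPolynomial.eval z P
  /-- `φ((aτ+b)/(cτ+d), w(z)) = (cτ+d)^k φ(τ, z)`. -/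
  transform : ∀ p ∈ trialityGroup, ∀ (τ : ℍ) (z : V),
    φ (p.1 • τ, p.2 z) = (((p.1 1 0 : ℤ) : ℂ) * τ + ((p.1 1 1 : ℤ) : ℂ)) ^ k * φ (τ, z)
  /-- `|φ(τ, z₁, z₂, z₃, q^{-1/2} Λ)|` has a finite limit as `q = e^{2πiτ} → 0`. -/
  cusp : ∀ z₁ z₂ z₃ Λ : ℂ, Λ ≠ 0 → ∃ l : ℝ,
    Tendsto (fun τ : ℍ => ‖φ (τ, ![z₁, z₂, z₃, cexp (-(Real.pi * Complex.I * τ)) * Λ])‖)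
      atImInfty (𝓝 l)

theorem isTrialityInvariant_one : IsTrialityInvariant 0 0 1 where
  holomorphic := by
    change DifferentiableOn ℂ (fun _ => (1 : ℂ)) _
    exact differentiableOn_const _
  homogeneous := fun τ => ⟨1, MvPolynomial.isHomogeneous_one _ _, by simp⟩
  transform := by simp
  cusp := fun _ _ _ _ _ => ⟨1, by simp⟩

theorem IsTrialityInvariant.mul {k k' : ℤ} {m m' : ℕ} {φ ψ : Fun}
    (hφ : IsTrialityInvariant k m φ) (hψ : IsTrialityInvariant k' m' ψ) :
    IsTrialityInvariant (k + k') (m + m') (φ * ψ) where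
  holomorphic := hφ.holomorphic.mul hψ.holomorphic
  homogeneous := by
    intro τ
    obtain ⟨P, hP, hP'⟩ := hφ.homogeneous τ
    obtain ⟨Q, hQ, hQ'⟩ := hψ.homogeneous τ
    exact ⟨P * Q, hP.mul hQ, fun z => by simp [hP', hQ']⟩
  transform := by
    intro p hp τ z
    have h0 : ((p.1 1 0 : ℤ) : ℂ) * τ + ((p.1 1 1 : ℤ) : ℂ) ≠ 0 := by
      have := UpperHalfPlane.denom_ne_zero (p.1 : GL (Fin 2) ℝ) τ
      simpa [UpperHalfPlane.denom] using this
    simp only [Pi.mul_apply, hφ.transform p hp, hψ.transform p hp, zpow_add₀ h0]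
    ring
  cusp := by
    intro z₁ z₂ z₃ Λ hΛ
    obtain ⟨l, hl⟩ := hφ.cusp z₁ z₂ z₃ Λ hΛ
    obtain ⟨l', hl'⟩ := hψ.cusp z₁ z₂ z₃ Λ hΛ
    exact ⟨l * l', by simpa using hl.mul hl'⟩

/-- The ring of `D₄` triality invariants: the finite sums of invariants of arbitrary weights and
degrees, as a ring of functions on `ℍ × ℂ⁴`. -/
def trialityRing : Subalgebra ℂ Fun :=
  (Submodule.span ℂ {φ : Fun | ∃ (k : ℤ) (m : ℕ), IsTrialityInvariant k m φ}).toSubalgebra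
    (Submodule.subset_span ⟨0, 0, isTrialityInvariant_one⟩)
    (fun x y hx hy => by
      have h := Submodule.mul_mem_mul hx hy
      rw [Submodule.span_mul_span] at h
      refine Submodule.span_mono ?_ h
      rintro _ ⟨φ, ⟨k, m, hφ⟩, ψ, ⟨k', m', hψ⟩, rfl⟩
      exact ⟨_, _, hφ.mul hψ⟩)

/-! ### The functions `K`, `L`, `M`, `N` -/

/-- The theta constant `ϑ₂ = ∑ q^((n - 1/2)² / 2)`, the sum over `n ∈ ℤ`. -/
def theta2 (τ : ℍ) : ℂ := ∑' n : ℤ, cexp (Real.pi * Complex.I * ((n : ℂ) - 1 / 2) ^ 2 * τ)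

/-- The theta constant `ϑ₃ = ∑ q^(n² / 2)`, the sum over `n ∈ ℤ`. -/
def theta3 (τ : ℍ) : ℂ := ∑' n : ℤ, cexp (Real.pi * Complex.I * (n : ℂ) ^ 2 * τ)

/-- The theta constant `ϑ₄ = ∑ (-1)^n q^(n² / 2)`, the sum over `n ∈ ℤ`. -/
def theta4 (τ : ℍ) : ℂ := ∑' n : ℤ, (-1 : ℂ) ^ n * cexp (Real.pi * Complex.I * (n : ℂ) ^ 2 * τ)

def e1 (τ : ℍ) : ℂ := (theta3 τ ^ 4 + theta4 τ ^ 4) / 12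

def e2 (τ : ℍ) : ℂ := (theta2 τ ^ 4 - theta4 τ ^ 4) / 12

def e3 (τ : ℍ) : ℂ := (-theta2 τ ^ 4 - theta3 τ ^ 4) / 12

/-- `I₂ = ∑ z_i²`. -/
def I2 (z : V) : ℂ := ∑ i, z i ^ 2

/-- `I₄ = ∑_{i < j} z_i² z_j²`. -/
def I4 (z : V) : ℂ := ∑ i, ∑ j ∈ Finset.Ioi i, z i ^ 2 * z j ^ 2

/-- `I₆ = ∑_{i < j < k} z_i² z_j² z_k²`. -/
def I6 (z : V) : ℂ := ∑ i, ∑ j ∈ Finset.Ioi i, ∑ k ∈ Finset.Ioi j, z i ^ 2 * z j ^ 2 * z k ^ 2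

/-- `Ĩ₄ = z₁ z₂ z₃ z₄`. -/
def I4tilde (z : V) : ℂ := ∏ i, z i

def T1 (z : V) : ℂ := I4 z / 6 - I2 z ^ 2 / 24

def T2 (z : V) : ℂ := -I4 z / 12 - I4tilde z / 2 + I2 z ^ 2 / 48

def T3 (z : V) : ℂ := -I4 z / 12 + I4tilde z / 2 + I2 z ^ 2 / 48

def K : Fun := fun p => I2 p.2

def L : Fun := fun p => e1 p.1 * T1 p.2 + e2 p.1 * T2 p.2 + e3 p.1 * T3 p.2

def M : Fun := fun p =>
  12 * (e1 p.1 ^ 2 * T1 p.2 + e2 p.1 ^ 2 * T2 p.2 + e3 p.1 ^ 2 * T3 p.2)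

def N : Fun := fun p => I6 p.2 / 4 - I2 p.2 * I4 p.2 / 24 + I2 p.2 ^ 3 / 96

/-! ### The polynomial ring `M_*[Δ⁻¹][K, L, M, N]` -/

/-- The ring `M_*` of modular forms on `SL₂(ℤ)`, as a ring of functions on `ℍ`. -/
def modularFormRing : Subalgebra ℂ (ℍ → ℂ) :=
  Algebra.adjoin ℂ {f : ℍ → ℂ | ∃ (k : ℕ) (F : ModularForm 𝒮ℒ k), f = ⇑F}

/-- The ring `M_*[Δ⁻¹]`, where `Δ = η²⁴` is the modular discriminant. -/
def modularFormRingInvDelta : Subalgebra ℂ (ℍ → ℂ) :=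
  Algebra.adjoin ℂ ((modularFormRing : Set (ℍ → ℂ)) ∪ {fun τ => (ModularForm.discriminant τ)⁻¹})

/-- Functions of `τ`, viewed as functions of `(τ, z)`. -/
def pullback : (ℍ → ℂ) →+* Fun where
  toFun f := fun p => f p.1
  map_one' := rfl
  map_mul' _ _ := rfl
  map_zero' := rfl
  map_add' _ _ := rfl

/-- Evaluation at `(K, L, M, N)` of a polynomial in four variables with coefficients in
`M_*[Δ⁻¹]`. -/
def evalKLMN : MvPolynomial (Fin 4) modularFormRingInvDelta →+* Fun :=
  MvPolynomial.eval₂Hom (pullback.comp modularFormRingInvDelta.val.toRingHom) ![K, L, M, N]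

end D4Triality

end

/-!
A `D₄` triality invariant `φ` of weight `k` is, at each `τ`, a homogeneous polynomial in `z` invariant
under `W(D₄)`, because `(1, w)` lies in the fibre product for `w ∈ W(D₄)`. Invariance under
permutations and even sign changes forces such a polynomial to be `A(z²) + z₁z₂z₃z₄ B(z²)` with `A`
and `B` symmetric, so it is a polynomial in `I₂, I₄, I₆, Ĩ₄`, equivalently in `I₂, T₁, T₂, N`
(`exists_eval_of_signedSwap`).

Since `e₁ + e₂ + e₃ = 0` and `T₁ + T₂ + T₃ = 0`, passing from `T₁, T₂` to `L, M` is a linear change of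
variables whose determinant is, up to a constant, `D = (e₁ - e₃)(e₂ - e₃)(e₂ - e₁)`. The modular group
permutes the `e_i` up to the factor of weight two, so `D²` is a cusp form of level one and weight
`12`, a multiple of `Δ`; the leading terms of the theta constants show that it is not zero
(`exists_diffProd_sq`). Hence `D` has no zeros on `ℍ` and `1 / D = D / (c Δ)`.

Two consequences follow. First, at each fixed `τ` the map `z ↦ (K, L, M, N)` is onto `ℂ⁴`, since any
values of `I₂, I₄, I₆, Ĩ₄` are attained (take square roots of the roots of a quartic). So a polynomial
in `K, L, M, N` determines its coefficients at each `τ`, which is the algebraic independence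
(`evalOver_injective`). Second, `φ` is a polynomial in `K, L, M, N` whose coefficients are
holomorphic in `τ`, with at most a pole at the cusp (`IsTrialityInvariant.mem_range_evalOver`): up to
powers of `1 / D` they are combinations of values `φ(τ, z)` at finitely many fixed `z`, and these are
bounded at `i∞` by the cusp condition and interpolation in `z₄`
(`IsTrialityInvariant.isBoundedAtImInfty`).

By uniqueness of the coefficients, the transformation laws of `φ, K, L, M, N` under the two generators
of `SL₂(ℤ)` show that the coefficient of `K^a L^b M^c N^d` is modular of weight `k - 2b - 4c`. Multiplied
by a power of `Δ` it becomes a modular form, so it lies in `M_*[Δ⁻¹]`.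
-/

noncomputable section

namespace D4Triality

open scoped ModularForm Manifold

/-! ### Theta constants -/

theorem theta3_eq (τ : ℍ) : theta3 τ = jacobiTheta₂ 0 τ :=
  jacobiTheta_eq_jacobiTheta₂ τ

theorem theta4_eq (τ : ℍ) : theta4 τ = jacobiTheta₂ (1 / 2) τ := by
  refine tsum_congr fun n => ?_
  rw [jacobiTheta₂_term, Complex.exp_add,
    show (2 * Real.pi * Complex.I * n * (1 / 2) : ℂ) = n * (Real.pi * Complex.I) by ring, Complex.exp_int_mul,
    Complex.exp_pi_mul_I]

theorem theta2_eq (τ : ℍ) :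
    theta2 τ = cexp (Real.pi * Complex.I * τ / 4) * jacobiTheta₂ (τ / 2) τ := by
  rw [← jacobiTheta₂_neg_left, jacobiTheta₂, ← tsum_mul_left]
  refine tsum_congr fun n => ?_
  rw [jacobiTheta₂_term, ← Complex.exp_add]
  ring_nf

theorem coe_S_smul (τ : ℍ) : ((ModularGroup.S • τ : ℍ) : ℂ) = -1 / τ := by
  rw [UpperHalfPlane.modular_S_smul]
  simp [neg_div, inv_neg]

theorem coe_T_smul (τ : ℍ) : ((ModularGroup.T • τ : ℍ) : ℂ) = τ + 1 := by
  rw [UpperHalfPlane.modular_T_smul]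
  simp [add_comm]

theorem cpow_half_pow_four (z : ℂ) : (z ^ (1 / 2 : ℂ)) ^ 4 = z ^ 2 := by
  rw [← Complex.cpow_nat_mul]
  norm_num

theorem cpow_half_ne_zero (τ : ℍ) : (-Complex.I * (τ : ℂ)) ^ (1 / 2 : ℂ) ≠ 0 := by
  simp [Complex.cpow_eq_zero_iff, τ.ne_zero]

theorem theta3_S (τ : ℍ) : theta3 (ModularGroup.S • τ) ^ 4 = -(τ : ℂ) ^ 2 * theta3 τ ^ 4 := by
  have h := jacobiTheta₂_functional_equation 0 τ
  rw [theta3_eq, theta3_eq, h, coe_S_smul]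
  have h0 := cpow_half_ne_zero τ
  have h4 := cpow_half_pow_four (-Complex.I * τ)
  simp only [zero_div, ne_eq, OfNat.ofNat_ne_zero, not_false_eq_true, zero_pow, mul_zero,
    Complex.exp_zero, mul_one, mul_pow, div_pow, one_pow, h4, I_sq, even_two, Even.neg_pow]
  field_simp [τ.ne_zero]

theorem theta2_S (τ : ℍ) : theta2 (ModularGroup.S • τ) ^ 4 = -(τ : ℂ) ^ 2 * theta4 τ ^ 4 := by
  have h := jacobiTheta₂_functional_equation (1 / 2) τ
  have e : -Real.pi * Complex.I * (1 / 2) ^ 2 / τ = Real.pi * Complex.I * (-1 / (τ : ℂ)) / 4 := by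
    field_simp [τ.ne_zero]; ring
  have e' : (1 / 2 : ℂ) / τ = -((-1 / (τ : ℂ)) / 2) := by
    field_simp [τ.ne_zero]
  rw [e, e', jacobiTheta₂_neg_left, mul_assoc, ← coe_S_smul, ← theta2_eq, ← theta4_eq] at h
  have h0 := cpow_half_ne_zero τ
  have h4 := cpow_half_pow_four (-Complex.I * τ)
  rw [h, mul_pow, div_pow, h4]
  simp only [mul_pow, I_sq, even_two, Even.neg_pow]
  field_simp [τ.ne_zero]

theorem theta4_S (τ : ℍ) : theta4 (ModularGroup.S • τ) ^ 4 = -(τ : ℂ) ^ 2 * theta2 τ ^ 4 := by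
  have h := jacobiTheta₂_functional_equation (τ / 2) τ
  have e : -Real.pi * Complex.I * (τ / 2) ^ 2 / τ = -(Real.pi * Complex.I * τ / 4) := by
    field_simp [τ.ne_zero]; ring
  have e' : (τ / 2 : ℂ) / τ = 1 / 2 := by
    field_simp [τ.ne_zero]
  rw [e, e', ← coe_S_smul, ← theta4_eq] at h
  have h' : theta2 τ = 1 / (-Complex.I * (τ : ℂ)) ^ (1 / 2 : ℂ) * theta4 (ModularGroup.S • τ) := by
    rw [theta2_eq, h, Complex.exp_neg]
    field_simp [Complex.exp_ne_zero]
  have h4 := cpow_half_pow_four (-Complex.I * τ)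
  rw [h', mul_pow, div_pow, h4]
  simp only [mul_pow, I_sq, even_two, Even.neg_pow]
  field_simp [τ.ne_zero]

theorem cexp_pi_sq (n : ℤ) : cexp (Real.pi * Complex.I * (n : ℂ) ^ 2) = (-1) ^ n := by
  rw [show (Real.pi * Complex.I * (n : ℂ) ^ 2 : ℂ) = ((n ^ 2 : ℤ) : ℂ) * (Real.pi * Complex.I) by push_cast; ring,
    Complex.exp_int_mul, Complex.exp_pi_mul_I]
  rcases Int.even_or_odd n with h | h
  · rw [h.neg_one_zpow, (h.pow_of_ne_zero two_ne_zero).neg_one_zpow]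
  · rw [h.neg_one_zpow, h.pow.neg_one_zpow]

theorem theta3_T (τ : ℍ) : theta3 (ModularGroup.T • τ) = theta4 τ := by
  refine tsum_congr fun n => ?_
  rw [coe_T_smul, mul_add, mul_one, Complex.exp_add, cexp_pi_sq, mul_comm]

theorem theta4_T (τ : ℍ) : theta4 (ModularGroup.T • τ) = theta3 τ := by
  refine tsum_congr fun n => ?_
  rw [coe_T_smul, mul_add, mul_one, Complex.exp_add, cexp_pi_sq, mul_comm, mul_assoc, ← mul_zpow]
  simp

theorem theta2_T (τ : ℍ) : theta2 (ModularGroup.T • τ) ^ 4 = -theta2 τ ^ 4 := by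
  have : theta2 (ModularGroup.T • τ) = cexp (Real.pi * Complex.I / 4) * theta2 τ := by
    rw [theta2, theta2, ← tsum_mul_left]
    refine tsum_congr fun n => ?_
    obtain ⟨k, hk⟩ := Int.even_mul_pred_self n
    have hk' : (n : ℂ) * (n - 1) = k + k := by exact_mod_cast hk
    rw [coe_T_smul, mul_add, Complex.exp_add, mul_comm,
      show (Real.pi * Complex.I * ((n : ℂ) - 1 / 2) ^ 2 * 1 : ℂ)
        = Real.pi * Complex.I / 4 + k * (2 * Real.pi * Complex.I) by linear_combination (Real.pi * Complex.I) * hk',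
      Complex.exp_add, Complex.exp_int_mul_two_pi_mul_I, mul_one]
  rw [this, mul_pow, ← Complex.exp_nat_mul,
    show ((4 : ℕ) * (Real.pi * Complex.I / 4) : ℂ) = Real.pi * Complex.I by push_cast; ring, Complex.exp_pi_mul_I]
  ring

theorem e1_S (τ : ℍ) : e1 (ModularGroup.S • τ) = (τ : ℂ) ^ 2 * e3 τ := by
  rw [e1, theta3_S, theta4_S, e3]; ring

theorem e2_S (τ : ℍ) : e2 (ModularGroup.S • τ) = (τ : ℂ) ^ 2 * e2 τ := by
  rw [e2, theta2_S, theta4_S, e2]; ring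

theorem e3_S (τ : ℍ) : e3 (ModularGroup.S • τ) = (τ : ℂ) ^ 2 * e1 τ := by
  rw [e3, theta2_S, theta3_S, e1]; ring

theorem e1_T (τ : ℍ) : e1 (ModularGroup.T • τ) = e1 τ := by
  rw [e1, theta3_T, theta4_T, e1]; ring

theorem e2_T (τ : ℍ) : e2 (ModularGroup.T • τ) = e3 τ := by
  rw [e2, theta2_T, theta4_T, e3]

theorem e3_T (τ : ℍ) : e3 (ModularGroup.T • τ) = e2 τ := by
  rw [e3, theta2_T, theta3_T, e2]; ring

theorem e1_add_e2_add_e3 (τ : ℍ) : e1 τ + e2 τ + e3 τ = 0 := by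
  rw [e1, e2, e3]; ring

/-- Termwise passage to the limit `Im τ → ∞` in a series `∑ cₙ exp (π i aₙ τ)` with nonnegative
exponents: only the terms with `aₙ = 0` survive. -/
theorem tendsto_tsum_cexp {c : ℤ → ℂ} {a : ℤ → ℝ} (hc : ∀ n, ‖c n‖ ≤ 1)
    (ha : ∀ n : ℤ, |(n : ℝ)| - 1 ≤ a n) (hca : ∀ n, c n ≠ 0 → 0 ≤ a n) :
    Tendsto (fun τ : ℍ => ∑' n, c n * cexp (Real.pi * Complex.I * a n * τ)) atImInfty
      (𝓝 (∑' n, if a n = 0 then c n else 0)) := by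
  have hnorm : ∀ (n : ℤ) (τ : ℍ), ‖cexp (Real.pi * Complex.I * a n * τ)‖ = Real.exp (-(Real.pi * a n) * τ.im) := by
    intro n τ
    rw [Complex.norm_exp]
    congr 1
    simp [Complex.mul_re, Complex.mul_im]
  have hsum : Summable fun n : ℤ => Real.exp Real.pi * Real.exp (-(Real.pi * |(n : ℝ)|)) := by
    refine Summable.mul_left _ ?_
    have h1 : Summable fun n : ℕ => Real.exp (-(Real.pi * (n : ℝ))) := by
      have := Real.summable_exp_nat_mul_iff.mpr (neg_lt_zero.mpr Real.pi_pos)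
      refine this.congr fun n => by ring_nf
    refine Summable.of_nat_of_neg ?_ ?_ <;> simpa using h1
  refine tendsto_tsum_of_dominated_convergence hsum (fun n => ?_) ?_
  · by_cases h : c n = 0
    · simp [h]
    by_cases h0 : a n = 0
    · simp [h0]
    rw [if_neg h0]
    have hpos : 0 < a n := lt_of_le_of_ne (hca n h) (Ne.symm h0)
    have : Tendsto (fun τ : ℍ => cexp (Real.pi * Complex.I * a n * τ)) atImInfty (𝓝 0) := by
      rw [tendsto_zero_iff_norm_tendsto_zero]
      simp only [hnorm]
      have him : Tendsto (fun τ : ℍ => τ.im) atImInfty atTop := tendsto_comap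
      exact Real.tendsto_exp_atBot.comp
        (him.const_mul_atTop_of_neg (neg_lt_zero.mpr (mul_pos Real.pi_pos hpos)))
    simpa using this.const_mul (c n)
  · have h1 : ∀ᶠ τ : ℍ in atImInfty, 1 ≤ τ.im := tendsto_comap.eventually_ge_atTop 1
    filter_upwards [h1] with τ hτ n
    by_cases h : c n = 0
    · simp only [h, zero_mul, norm_zero]; positivity
    rw [norm_mul, hnorm, ← Real.exp_add]
    calc ‖c n‖ * Real.exp (-(Real.pi * a n) * τ.im) ≤ 1 * Real.exp (-(Real.pi * a n) * τ.im) := by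
          gcongr; exact hc n
      _ ≤ _ := by
          rw [one_mul]
          apply Real.exp_le_exp.mpr
          have h2 : Real.pi * a n ≤ (Real.pi * a n) * τ.im :=
            le_mul_of_one_le_right (mul_nonneg Real.pi_pos.le (hca n h)) hτ
          have h3 := mul_le_mul_of_nonneg_left (ha n) Real.pi_pos.le
          linarith

theorem tendsto_theta3 : Tendsto theta3 atImInfty (𝓝 1) := by
  have := tendsto_tsum_cexp (c := fun _ => 1) (a := fun n => (n : ℝ) ^ 2) (by simp)
    (fun n => by rw [← sq_abs]; nlinarith [sq_nonneg (|(n : ℝ)| - 1), abs_nonneg (n : ℝ)])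
    (fun n _ => sq_nonneg _)
  rw [tsum_eq_single 0 (by intro n hn; simp [hn])] at this
  simpa [theta3] using! this

theorem tendsto_theta4 : Tendsto theta4 atImInfty (𝓝 1) := by
  have := tendsto_tsum_cexp (c := fun n => (-1) ^ n) (a := fun n => (n : ℝ) ^ 2) (by simp)
    (fun n => by rw [← sq_abs]; nlinarith [sq_nonneg (|(n : ℝ)| - 1), abs_nonneg (n : ℝ)])
    (fun n _ => sq_nonneg _)
  rw [tsum_eq_single 0 (by intro n hn; simp [hn])] at this
  simpa [theta4] using! this

theorem sub_half_ne_zero (n : ℤ) : ((n : ℝ) - 1 / 2) ≠ 0 := by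
  intro h
  have h2 : (2 * n : ℤ) = 1 := by
    have : (2 * n : ℝ) = 1 := by linarith
    exact_mod_cast this
  omega

theorem tendsto_theta2 : Tendsto theta2 atImInfty (𝓝 0) := by
  have := tendsto_tsum_cexp (c := fun _ => 1) (a := fun n => ((n : ℝ) - 1 / 2) ^ 2) (by simp)
    (fun n => by
      rcases abs_cases (n : ℝ) with ⟨h, _⟩ | ⟨h, _⟩ <;> rw [h] <;>
      nlinarith [sq_nonneg ((n : ℝ) - 1), sq_nonneg (n : ℝ)])
    (fun n _ => sq_nonneg _)
  simp only [sq_eq_zero_iff, sub_half_ne_zero, if_false, tsum_zero] at this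
  simpa only [one_mul, Complex.ofReal_pow, Complex.ofReal_sub, Complex.ofReal_intCast,
    Complex.ofReal_div, Complex.ofReal_one, Complex.ofReal_ofNat] using! this

/-- `q^{-1/8} ϑ₂ → 2`. -/
theorem tendsto_theta2_div :
    Tendsto (fun τ : ℍ => theta2 τ / cexp (Real.pi * Complex.I * τ / 4)) atImInfty (𝓝 2) := by
  have := tendsto_tsum_cexp (c := fun _ => 1) (a := fun n => (n : ℝ) * (n - 1)) (by simp)
    (fun n => by
      rcases abs_cases (n : ℝ) with ⟨h, _⟩ | ⟨h, _⟩ <;> rw [h] <;>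
      nlinarith [sq_nonneg ((n : ℝ) - 1), sq_nonneg (n : ℝ)])
    (fun n _ => by
      have : 0 ≤ n * (n - 1) := by
        rcases le_or_gt n 0 with h | h <;> nlinarith
      exact_mod_cast this)
  rw [tsum_eq_sum (s := {0, 1})] at this
  · refine (this.congr fun τ => ?_).trans (by rw [Finset.sum_pair zero_ne_one]; norm_num)
    rw [theta2, ← tsum_div_const]
    refine tsum_congr fun n => ?_
    rw [← Complex.exp_sub, one_mul]
    congr 1
    push_cast
    ring
  · intro n hn
    simp only [Finset.mem_insert, Finset.mem_singleton, not_or] at hn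
    rw [if_neg]
    have : n * (n - 1) ≠ 0 := mul_ne_zero hn.1 (sub_ne_zero.mpr hn.2)
    exact_mod_cast this

theorem summable_theta3 (τ : ℍ) : Summable fun n : ℤ => cexp (Real.pi * Complex.I * (n : ℂ) ^ 2 * τ) := by
  have := (summable_jacobiTheta₂_term_iff 0 τ).mpr τ.im_pos
  refine this.congr fun n => ?_
  rw [jacobiTheta₂_term]; ring_nf

/-- `q^{-1/2} (ϑ₃ - ϑ₄) → 4`. -/
theorem tendsto_theta3_sub_theta4_div :
    Tendsto (fun τ : ℍ => (theta3 τ - theta4 τ) / cexp (Real.pi * Complex.I * τ)) atImInfty (𝓝 4) := by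
  have := tendsto_tsum_cexp (c := fun n => (1 - (-1) ^ n) / 2) (a := fun n => (n : ℝ) ^ 2 - 1)
    (fun n => by rcases Int.even_or_odd n with h | h <;> simp [h.neg_one_zpow])
    (fun n => by
      have : |n| ≤ n ^ 2 := by rw [← sq_abs]; exact Int.le_self_sq |n|
      have : |(n : ℝ)| ≤ (n : ℝ) ^ 2 := by exact_mod_cast this
      linarith)
    (fun n hn => by
      have h0 : n ≠ 0 := by rintro rfl; simp at hn
      have : 1 ≤ n ^ 2 := by have := sq_pos_of_ne_zero h0; omega
      have : (1 : ℝ) ≤ (n : ℝ) ^ 2 := by exact_mod_cast this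
      linarith)
  rw [tsum_eq_sum (s := {1, -1})] at this
  · have h2 := this.const_mul 2
    refine (h2.congr fun τ => ?_).trans (by simp; norm_num)
    rw [theta3, theta4, ← Summable.tsum_sub (summable_theta3 τ), ← tsum_div_const, ← tsum_mul_left]
    · refine tsum_congr fun n => ?_
      have : cexp (Real.pi * Complex.I * (n : ℂ) ^ 2 * τ) =
          cexp (Real.pi * Complex.I * ((n ^ 2 - 1 : ℝ) : ℂ) * τ) * cexp (Real.pi * Complex.I * τ) := by
        rw [← Complex.exp_add]; congr 1; push_cast; ring
      rw [this]
      field_simp [Complex.exp_ne_zero]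
    · rw [← summable_norm_iff]
      simpa using (summable_norm_iff.mpr (summable_theta3 τ))
  · intro n hn
    simp only [Finset.mem_insert, Finset.mem_singleton, not_or] at hn
    rw [if_neg]
    intro h
    have h' : n ^ 2 = 1 := by
      have : (n : ℝ) ^ 2 = 1 := by linarith
      exact_mod_cast this
    rcases sq_eq_one_iff.mp h' with h | h <;> simp_all

/-! ### Modular forms of level one from the two generators -/

theorem slash_eq_self_of_generators {f : ℍ → ℂ} {k : ℤ}
    (hT : ∀ τ, f (ModularGroup.T • τ) = f τ)
    (hS : ∀ τ : ℍ, f (ModularGroup.S • τ) = (τ : ℂ) ^ k * f τ) (γ : SL(2, ℤ)) :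
    f ∣[k] γ = f := by
  refine SlashInvariantForm.slash_action_generators_SL2Z ?_ ?_ γ <;> funext τ <;>
    rw [ModularForm.slash_action_eq'_iff]
  · simpa [ModularGroup.S] using hS τ
  · simpa [ModularGroup.T] using hT τ

theorem exists_modularForm_of_generators {f : ℍ → ℂ} {k : ℤ} (hf : MDiff f)
    (hb : IsBoundedAtImInfty f) (hT : ∀ τ, f (ModularGroup.T • τ) = f τ)
    (hS : ∀ τ : ℍ, f (ModularGroup.S • τ) = (τ : ℂ) ^ k * f τ) :
    ∃ F : ModularForm 𝒮ℒ k, ⇑F = f := by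
  have h := slash_eq_self_of_generators hT hS
  refine ⟨{ toFun := f, slash_action_eq' := ?_, holo' := hf, bdd_at_cusps' := ?_ }, rfl⟩
  · rintro _ ⟨γ, rfl⟩
    exact h γ
  · intro c hc
    rw [Subgroup.IsArithmetic.isCusp_iff_isCusp_SL2Z] at hc
    rw [OnePoint.isBoundedAt_iff_forall_SL2Z hc]
    intro γ _
    rw [h]
    exact hb

theorem exists_cuspForm_of_generators {f : ℍ → ℂ} {k : ℤ} (hf : MDiff f)
    (hb : IsZeroAtImInfty f) (hT : ∀ τ, f (ModularGroup.T • τ) = f τ)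
    (hS : ∀ τ : ℍ, f (ModularGroup.S • τ) = (τ : ℂ) ^ k * f τ) :
    ∃ F : CuspForm 𝒮ℒ k, ⇑F = f := by
  have h := slash_eq_self_of_generators hT hS
  refine ⟨{ toFun := f, slash_action_eq' := ?_, holo' := hf, zero_at_cusps' := ?_ }, rfl⟩
  · rintro _ ⟨γ, rfl⟩
    exact h γ
  · intro c hc
    rw [Subgroup.IsArithmetic.isCusp_iff_isCusp_SL2Z] at hc
    rw [OnePoint.isZeroAt_iff_forall_SL2Z hc]
    intro γ _
    rw [h]
    exact hb

/-! ### The difference product of `e₁, e₂, e₃` -/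

theorem mdifferentiable_theta3 : MDiff theta3 := by
  rw [UpperHalfPlane.mdifferentiable_iff]
  refine DifferentiableOn.congr (f := jacobiTheta₂ 0) (fun z hz =>
    (differentiableAt_jacobiTheta₂_snd 0 hz).differentiableWithinAt) fun z hz => ?_
  simp [theta3_eq, ofComplex_apply_of_im_pos hz]

theorem mdifferentiable_theta4 : MDiff theta4 := by
  rw [UpperHalfPlane.mdifferentiable_iff]
  refine DifferentiableOn.congr (f := jacobiTheta₂ (1 / 2)) (fun z hz =>
    (differentiableAt_jacobiTheta₂_snd (1 / 2) hz).differentiableWithinAt) fun z hz => ?_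
  simp [theta4_eq, ofComplex_apply_of_im_pos hz]

theorem mdifferentiable_theta2 : MDiff theta2 := by
  rw [UpperHalfPlane.mdifferentiable_iff]
  refine DifferentiableOn.congr
    (f := fun z => cexp (Real.pi * Complex.I * z / 4) * jacobiTheta₂ (z / 2) z)
    (fun z hz => DifferentiableAt.differentiableWithinAt ?_) fun z hz => ?_
  · refine DifferentiableAt.mul (by fun_prop) ?_
    have h := (hasFDerivAt_jacobiTheta₂ (z / 2) hz).differentiableAt
    exact DifferentiableAt.comp (g := fun p : ℂ × ℂ => jacobiTheta₂ p.1 p.2)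
      (f := fun z : ℂ => (z / 2, z)) z h (by fun_prop)
  · simp [theta2_eq, ofComplex_apply_of_im_pos hz]

theorem mdifferentiable_e1 : MDiff e1 := by
  have h : e1 = fun τ => (1 / 12 : ℂ) * (theta3 τ ^ 4 + theta4 τ ^ 4) := by
    funext τ; rw [e1]; ring
  rw [h]
  exact mdifferentiable_const.mul ((mdifferentiable_theta3.pow 4).add (mdifferentiable_theta4.pow 4))

theorem mdifferentiable_e2 : MDiff e2 := by
  have h : e2 = fun τ => (1 / 12 : ℂ) * (theta2 τ ^ 4 - theta4 τ ^ 4) := by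
    funext τ; rw [e2]; ring
  rw [h]
  exact mdifferentiable_const.mul ((mdifferentiable_theta2.pow 4).sub (mdifferentiable_theta4.pow 4))

theorem mdifferentiable_e3 : MDiff e3 := by
  have h : e3 = fun τ => (-1 / 12 : ℂ) * (theta2 τ ^ 4 + theta3 τ ^ 4) := by
    funext τ; rw [e3]; ring
  rw [h]
  exact mdifferentiable_const.mul ((mdifferentiable_theta2.pow 4).add (mdifferentiable_theta3.pow 4))

theorem tendsto_e1 : Tendsto e1 atImInfty (𝓝 (1 / 6)) := by
  refine (((tendsto_theta3.pow 4).add (tendsto_theta4.pow 4)).div_const 12).trans ?_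
  norm_num

theorem tendsto_e2 : Tendsto e2 atImInfty (𝓝 (-1 / 12)) := by
  refine (((tendsto_theta2.pow 4).sub (tendsto_theta4.pow 4)).div_const 12).trans ?_
  norm_num

theorem tendsto_e3 : Tendsto e3 atImInfty (𝓝 (-1 / 12)) := by
  refine (((tendsto_theta2.pow 4).neg.sub (tendsto_theta3.pow 4)).div_const 12).trans ?_
  norm_num

theorem tendsto_e2_sub_e3_div :
    Tendsto (fun τ : ℍ => (e2 τ - e3 τ) / cexp (Real.pi * Complex.I * τ)) atImInfty (𝓝 4) := by
  have h3 := tendsto_theta3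
  have h4 := tendsto_theta4
  have h := (((tendsto_theta2_div.pow 4).const_mul 2).add
    (tendsto_theta3_sub_theta4_div.mul
      (((h3.pow 3).add ((h3.pow 2).mul h4)).add ((h3.mul (h4.pow 2)).add (h4.pow 3))))).div_const 12
  refine (h.congr fun τ => ?_).trans (by norm_num)
  have h8 : cexp (Real.pi * Complex.I * τ / 4) ^ 4 = cexp (Real.pi * Complex.I * τ) := by
    rw [← Complex.exp_nat_mul]; congr 1; push_cast; ring
  rw [div_pow, h8, e2, e3]
  ring

/-- The difference product `(e₁ - e₃)(e₂ - e₃)(e₂ - e₁)`, up to a factor the determinant of the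
transition from `T₁, T₂` to `L, M`. -/
def diffProd (τ : ℍ) : ℂ := (e1 τ - e3 τ) * (e2 τ - e3 τ) * (e2 τ - e1 τ)

theorem mdifferentiable_diffProd : MDiff diffProd :=
  ((mdifferentiable_e1.sub mdifferentiable_e3).mul (mdifferentiable_e2.sub mdifferentiable_e3)).mul
    (mdifferentiable_e2.sub mdifferentiable_e1)

theorem exists_diffProd_ne_zero : ∃ τ, diffProd τ ≠ 0 := by
  have h := ((tendsto_e1.sub tendsto_e3).mul tendsto_e2_sub_e3_div).mul (tendsto_e2.sub tendsto_e1)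
  obtain ⟨τ, hτ⟩ := (h.eventually_ne (by norm_num : _ ≠ (0 : ℂ))).exists
  refine ⟨τ, fun h0 => hτ ?_⟩
  rw [diffProd] at h0
  rw [mul_div_assoc', div_mul_eq_mul_div, h0, zero_div]

/-- The square of the difference product is a cusp form of weight `12`, hence a nonzero multiple
of `Δ`. -/
theorem exists_diffProd_sq :
    ∃ c : ℂ, c ≠ 0 ∧ ∀ τ, diffProd τ ^ 2 = c * ModularForm.discriminant τ := by
  have hz : IsZeroAtImInfty fun τ => diffProd τ ^ 2 := by
    refine (((((tendsto_e1.sub tendsto_e3).mul (tendsto_e2.sub tendsto_e3)).mul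
      (tendsto_e2.sub tendsto_e1))).pow 2).trans ?_
    norm_num
  obtain ⟨F, hF⟩ := exists_cuspForm_of_generators (k := 12) (mdifferentiable_diffProd.pow 2) hz
    (fun τ => by simp only [Pi.pow_apply, diffProd, e1_T, e2_T, e3_T]; ring)
    (fun τ => by
      simp only [Pi.pow_apply, diffProd, e1_S, e2_S, e3_S]
      rw [show ((τ : ℂ) ^ (12 : ℤ)) = (τ : ℂ) ^ 12 by norm_cast]
      ring)
  obtain ⟨c, hc⟩ := CuspForm.exists_smul_discriminant_of_weight_eq_twelve F
  have hD : ∀ τ, diffProd τ ^ 2 = c * ModularForm.discriminant τ := by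
    intro τ
    have := congrArg (fun G : CuspForm 𝒮ℒ 12 => G τ) hc
    have hF' := congrFun hF τ
    simp only [Pi.pow_apply] at hF'
    rw [← hF']
    simpa using this.symm
  refine ⟨c, ?_, hD⟩
  rintro rfl
  obtain ⟨τ, hτ⟩ := exists_diffProd_ne_zero
  exact hτ (by simpa using hD τ)

theorem diffProd_ne_zero (τ : ℍ) : diffProd τ ≠ 0 := by
  obtain ⟨c, hc, h⟩ := exists_diffProd_sq
  intro h0
  have := h τ
  rw [h0, zero_pow two_ne_zero] at this
  exact mul_ne_zero hc (ModularForm.discriminant_ne_zero τ) this.symm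

/-! ### Signed transpositions in `W(D₄)` -/

/-- The reflection `z_i ↦ ε z_j`, `z_j ↦ ε z_i` (`ε = ±1`) in the root `e_i - ε e_j` of `D₄`, when
`i ≠ j`. -/
def signedSwap (i j : Fin 4) (ε : ℤˣ) : V ≃ₗ[ℂ] V :=
  LinearEquiv.ofInvolutive
    { toFun := fun z l => (if l = i ∨ l = j then ((ε : ℤ) : ℂ) else 1) * z (Equiv.swap i j l)
      map_add' := fun z z' => by ext l; simp [mul_add]
      map_smul' := fun c z => by ext l; simp [mul_left_comm] }
    (fun z => by
      ext l
      have hε : ((ε : ℤ) : ℂ) * ((ε : ℤ) : ℂ) = 1 := by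
        rw [← Int.cast_mul, ← Units.val_mul, Int.units_mul_self]; simp
      simp only [LinearMap.coe_mk, AddHom.coe_mk, Equiv.swap_apply_self]
      by_cases hi : l = i
      · subst hi; simp [← mul_assoc, hε]
      by_cases hj : l = j
      · subst hj; simp [← mul_assoc, hε]
      simp [hi, hj, Equiv.swap_apply_of_ne_of_ne hi hj])

theorem signedSwap_apply (i j : Fin 4) (ε : ℤˣ) (z : V) (l : Fin 4) :
    signedSwap i j ε z l =
      (if l = i ∨ l = j then ((ε : ℤ) : ℂ) else 1) * z (Equiv.swap i j l) := rfl

theorem cast_units_eq (ε : ℤˣ) : ((ε : ℤ) : ℂ) = 1 ∨ ((ε : ℤ) : ℂ) = -1 := by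
  rcases Int.units_eq_one_or ε with rfl | rfl <;> simp

theorem signedSwap_mem_weylF4 {i j : Fin 4} (hij : i ≠ j) (ε : ℤˣ) :
    signedSwap i j ε ∈ weylF4 := by
  have hε : ((ε : ℤ) : ℂ) * ((ε : ℤ) : ℂ) = 1 := by
    rw [← Int.cast_mul, ← Units.val_mul, Int.units_mul_self]; simp
  refine Subgroup.subset_closure ⟨Pi.single i 1 + Pi.single j (-((ε : ℤ) : ℂ)),
    Or.inl (Or.inl ⟨i, j, hij, 1, _, Or.inl rfl, ?_, rfl⟩), fun z => ?_⟩
  · rcases cast_units_eq ε with h | h <;> simp [h]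
  · have h2 : (Pi.single i 1 + Pi.single j (-((ε : ℤ) : ℂ)) : V) ⬝ᵥ
        (Pi.single i 1 + Pi.single j (-((ε : ℤ) : ℂ))) = 2 := by
      simp only [add_dotProduct, single_dotProduct, Pi.add_apply, Pi.single_eq_same,
        Pi.single_eq_of_ne hij, Pi.single_eq_of_ne hij.symm]
      linear_combination hε
    rw [h2]
    ext l
    rw [signedSwap_apply]
    simp only [add_dotProduct, single_dotProduct, Pi.sub_apply, Pi.smul_apply, Pi.add_apply,
      smul_eq_mul]
    by_cases hi : l = i
    · subst hi
      simp only [true_or, if_true, Equiv.swap_apply_left, Pi.single_eq_same,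
        Pi.single_eq_of_ne hij]
      ring
    by_cases hj : l = j
    · subst hj
      simp only [or_true, if_true, Equiv.swap_apply_right, Pi.single_eq_same,
        Pi.single_eq_of_ne hij.symm]
      linear_combination z l * hε
    simp [hi, hj, Equiv.swap_apply_of_ne_of_ne hi hj]

theorem prod_signedSwap {i j : Fin 4} (hij : i ≠ j) (ε : ℤˣ) (z : V) :
    ∏ l, signedSwap i j ε z l = ∏ l, z l := by
  have hε : ((ε : ℤ) : ℂ) * ((ε : ℤ) : ℂ) = 1 := by
    rw [← Int.cast_mul, ← Units.val_mul, Int.units_mul_self]; simp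
  simp only [signedSwap_apply]
  rw [Finset.prod_mul_distrib, Equiv.prod_comp (Equiv.swap i j) z, Finset.prod_ite]
  have : (Finset.univ.filter fun l => l = i ∨ l = j) = {i, j} := by ext l; simp
  rw [this, Finset.prod_pair hij, hε]
  simp

theorem signedSwap_mem_trialityGroup {i j : Fin 4} (hij : i ≠ j) (ε : ℤˣ) :
    ((1 : SL(2, ℤ)), signedSwap i j ε) ∈ trialityGroup := by
  apply mem_trialityGroup_of_mapsTo (signedSwap_mem_weylF4 hij ε)
  · intro z
    exact (signedSwap i j ε).symm_apply_apply z
  · have hhalf : ∀ z : V, (∀ l, z l = 1 / 2 ∨ z l = -1 / 2) →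
        ∀ l, signedSwap i j ε z l = 1 / 2 ∨ signedSwap i j ε z l = -1 / 2 := by
      intro z hz l
      rw [signedSwap_apply]
      split_ifs
      · rcases cast_units_eq ε with h | h <;> rcases hz (Equiv.swap i j l) with h' | h' <;>
          rw [h, h'] <;> norm_num
      · simpa using hz _
    simp only [map_one, Matrix.SpecialLinearGroup.coe_one, Matrix.one_mulVec]
    rw [forall_zmod2, minimalWeights_00, minimalWeights_10, minimalWeights_01, minimalWeights_11]
    refine ⟨?_, ?_, ?_, ?_⟩
    · simp
    · have key : ∀ (k : Fin 4) (c : ℂ), signedSwap i j ε (Pi.single k c) =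
          Pi.single (Equiv.swap i j k)
            ((if Equiv.swap i j k = i ∨ Equiv.swap i j k = j then ((ε : ℤ) : ℂ) else 1) * c) := by
        intro k c
        ext l
        rw [signedSwap_apply]
        by_cases h : l = Equiv.swap i j k
        · subst h; simp
        · have h' : Equiv.swap i j l ≠ k := by rintro rfl; simp at h
          simp [h, h']
      rintro z ⟨k, rfl | rfl⟩ <;> rw [key] <;> refine ⟨Equiv.swap i j k, ?_⟩ <;> split_ifs <;>
        rcases cast_units_eq ε with h | h <;> simp [h]
    · rintro z ⟨hz, hz'⟩
      exact ⟨hhalf z hz, by rw [prod_signedSwap hij, hz']⟩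
    · rintro z ⟨hz, hz'⟩
      exact ⟨hhalf z hz, by rw [prod_signedSwap hij, hz']⟩
  · simp

/-! ### Polynomial invariants of `W(D₄)` -/

open MvPolynomial

theorem eval_bind₁ {σ τ R : Type*} [CommRing R] (f : τ → R) (g : σ → MvPolynomial τ R)
    (p : MvPolynomial σ R) : eval f (bind₁ g p) = eval (fun i => eval f (g i)) p :=
  eval₂Hom_bind₁ _ _ _ _

/-- The substitution `X_i ↦ c_i X_i`. -/
def scaleVars (c : V) : MvPolynomial (Fin 4) ℂ →ₐ[ℂ] MvPolynomial (Fin 4) ℂ :=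
  aeval fun i => C (c i) * X i

theorem eval_scaleVars (c z : V) (P : MvPolynomial (Fin 4) ℂ) :
    eval z (scaleVars c P) = eval (c * z) P := by
  change eval z (bind₁ (fun i => C (c i) * X i) P) = _
  rw [eval_bind₁]
  simp [Pi.mul_def]

theorem coeff_scaleVars (c : V) (P : MvPolynomial (Fin 4) ℂ) (α : Fin 4 →₀ ℕ) :
    coeff α (scaleVars c P) = (∏ i, c i ^ α i) * coeff α P := by
  induction P using MvPolynomial.induction_on' with
  | monomial u a =>
    have : scaleVars c (monomial u a) = monomial u ((∏ i, c i ^ u i) * a) := by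
      rw [scaleVars, aeval_monomial, Finsupp.prod_fintype _ _ (by simp), mul_comm _ a,
        ← C_mul_monomial, monomial_eq (a := ∏ i, c i ^ u i), Finsupp.prod_fintype _ _ (by simp)]
      simp [mul_pow, Finset.prod_mul_distrib]
    rw [this, coeff_monomial, coeff_monomial]
    split_ifs with h
    · rw [h]
    · simp
  | add p q hp hq => rw [map_add, coeff_add, hp, hq, coeff_add, mul_add]

theorem isSymmetric_of_signedSwap {P : MvPolynomial (Fin 4) ℂ}
    (hP : ∀ i j, i ≠ j → ∀ ε z, eval (signedSwap i j ε z) P = eval z P) : P.IsSymmetric := by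
  intro e
  induction e using Equiv.Perm.swap_induction_on with
  | one => simp
  | swap_mul f i j hij ih =>
    rw [Equiv.Perm.coe_mul, ← rename_rename, ih]
    refine MvPolynomial.funext fun z => ?_
    rw [eval_rename, ← hP i j hij 1 z]
    congr 2
    ext l
    simp [signedSwap_apply]

/-- Invariance under the sign changes of two coordinates forces all exponents of a monomial to have
the same parity. -/
theorem parity_of_signedSwap {P : MvPolynomial (Fin 4) ℂ}
    (hP : ∀ i j, i ≠ j → ∀ ε z, eval (signedSwap i j ε z) P = eval z P) {α : Fin 4 →₀ ℕ}
    (hα : α ∈ P.support) (i j : Fin 4) : α i % 2 = α j % 2 := by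
  by_cases hij : i = j
  · rw [hij]
  let c : V := fun l => if l = i ∨ l = j then -1 else 1
  have hc : scaleVars c P = P := by
    refine MvPolynomial.funext fun z => ?_
    rw [eval_scaleVars, ← hP i j hij (-1) z, ← hP i j hij 1 (signedSwap i j (-1) z)]
    congr 2
    ext l
    by_cases hi : l = i
    · subst hi; simp [signedSwap_apply, c]
    by_cases hj : l = j
    · subst hj; simp [signedSwap_apply, c]
    simp [signedSwap_apply, c, hi, hj, Equiv.swap_apply_of_ne_of_ne hi hj]
  have h := coeff_scaleVars c P α
  rw [hc] at h
  have h1 : ∏ l, c l ^ α l = 1 := by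
    have := mem_support_iff.mp hα
    exact mul_right_cancel₀ this (by rw [one_mul]; exact h.symm)
  have h2 : ∏ l, c l ^ α l = (-1) ^ (α i + α j) := by
    have : ∀ l, c l ^ α l = if l = i ∨ l = j then (-1) ^ α l else 1 := by
      intro l; simp only [c]; split_ifs <;> simp
    simp only [this]
    rw [Finset.prod_ite]
    have : (Finset.univ.filter fun l => l = i ∨ l = j) = {i, j} := by ext l; simp
    rw [this, Finset.prod_pair hij, pow_add]
    simp
  rw [h2, neg_one_pow_eq_one_iff_even (by norm_num)] at h1
  rcases h1 with ⟨r, hr⟩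
  omega

/-- The exponent `2 β + γ (1, 1, 1, 1)`. -/
def doubleAdd (γ : ℕ) (β : Fin 4 →₀ ℕ) : Fin 4 →₀ ℕ :=
  Finsupp.equivFunOnFinite.symm fun i => 2 * β i + γ

theorem doubleAdd_apply (γ : ℕ) (β : Fin 4 →₀ ℕ) (i : Fin 4) : doubleAdd γ β i = 2 * β i + γ := rfl

theorem doubleAdd_injective (γ : ℕ) : Function.Injective (doubleAdd γ) := by
  intro β β' h
  ext i
  have := DFunLike.congr_fun h i
  simp only [doubleAdd_apply] at this
  omega

/-- Halving of exponents, rounded down. -/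
def halve (α : Fin 4 →₀ ℕ) : Fin 4 →₀ ℕ := Finsupp.equivFunOnFinite.symm fun i => α i / 2

theorem halve_doubleAdd {γ : ℕ} (hγ : γ < 2) (β : Fin 4 →₀ ℕ) : halve (doubleAdd γ β) = β := by
  ext i
  change (2 * β i + γ) / 2 = β i
  omega

/-- The polynomial with coefficient of `X^β` that of `X^(2β + γ(1,1,1,1))` in `P`, for `γ = 0, 1`. -/
def parityPart (γ : ℕ) (P : MvPolynomial (Fin 4) ℂ) : MvPolynomial (Fin 4) ℂ :=
  ∑ β ∈ P.support.image halve, monomial β (coeff (doubleAdd γ β) P)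

theorem coeff_parityPart {γ : ℕ} (hγ : γ < 2) (P : MvPolynomial (Fin 4) ℂ) (β : Fin 4 →₀ ℕ) :
    coeff β (parityPart γ P) = coeff (doubleAdd γ β) P := by
  rw [parityPart, coeff_sum]
  simp only [coeff_monomial]
  rw [Finset.sum_ite_eq' (P.support.image halve) β]
  split_ifs with h
  · rfl
  · by_contra hne
    exact h (Finset.mem_image.mpr ⟨_, mem_support_iff.mpr (Ne.symm hne), halve_doubleAdd hγ β⟩)

theorem parityPart_isSymmetric {γ : ℕ} (hγ : γ < 2) {P : MvPolynomial (Fin 4) ℂ}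
    (hP : P.IsSymmetric) : (parityPart γ P).IsSymmetric := by
  intro e
  ext β
  obtain ⟨β, rfl⟩ : ∃ β', Finsupp.mapDomain e β' = β :=
    ⟨Finsupp.mapDomain e.symm β, by rw [← Finsupp.mapDomain_comp]; simp⟩
  rw [coeff_rename_mapDomain _ e.injective, coeff_parityPart hγ, coeff_parityPart hγ]
  have : doubleAdd γ (Finsupp.mapDomain e β) = Finsupp.mapDomain e (doubleAdd γ β) := by
    ext i
    obtain ⟨i, rfl⟩ := e.surjective i
    rw [Finsupp.mapDomain_apply e.injective, doubleAdd_apply, doubleAdd_apply,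
      Finsupp.mapDomain_apply e.injective]
  rw [this]
  conv_rhs => rw [← hP e]
  rw [coeff_rename_mapDomain _ e.injective]

/-- The decomposition `P(z) = A(z²) + z₁z₂z₃z₄ B(z²)` by parity of the exponents. -/
theorem eval_eq_parityPart {P : MvPolynomial (Fin 4) ℂ}
    (hP : ∀ α ∈ P.support, ∀ i j, α i % 2 = α j % 2) (z : V) :
    eval z P = eval (z ^ 2) (parityPart 0 P) + (∏ i, z i) * eval (z ^ 2) (parityPart 1 P) := by
  have key : ∀ γ < 2, ∑ α ∈ P.support.filter (fun α => α 0 % 2 = γ), coeff α P * ∏ i, z i ^ α i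
      = (∏ i, z i) ^ γ * eval (z ^ 2) (parityPart γ P) := by
    intro γ hγ
    have h1 : (∏ i, z i) ^ γ * eval (z ^ 2) (parityPart γ P) =
        ∑ α ∈ (P.support.image halve).image (doubleAdd γ), coeff α P * ∏ i, z i ^ α i := by
      rw [Finset.sum_image (fun _ _ _ _ h => doubleAdd_injective γ h), parityPart, map_sum,
        Finset.mul_sum]
      refine Finset.sum_congr rfl fun β _ => ?_
      rw [eval_monomial, Finsupp.prod_fintype _ _ (by simp), mul_left_comm, ← Finset.prod_pow,
        ← Finset.prod_mul_distrib]
      congr 1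
      refine Finset.prod_congr rfl fun i _ => ?_
      rw [doubleAdd_apply, pow_add, pow_mul, Pi.pow_apply, mul_comm]
    rw [h1]
    refine Finset.sum_subset (fun α hα => ?_) (fun α hα hα' => ?_)
    · obtain ⟨hα, hαγ⟩ := Finset.mem_filter.mp hα
      refine Finset.mem_image.mpr ⟨halve α, Finset.mem_image_of_mem _ hα, ?_⟩
      ext i
      change 2 * (α i / 2) + γ = α i
      have := hP α hα i 0
      omega
    · obtain ⟨β, _, rfl⟩ := Finset.mem_image.mp hα
      have : coeff (doubleAdd γ β) P = 0 := by
        by_contra h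
        refine hα' (Finset.mem_filter.mpr ⟨mem_support_iff.mpr h, ?_⟩)
        rw [doubleAdd_apply]
        omega
      rw [this, zero_mul]
  have h0 := key 0 two_pos
  have h1 := key 1 one_lt_two
  rw [pow_zero, one_mul] at h0
  rw [pow_one] at h1
  rw [← h0, ← h1, eval_eq', ← Finset.sum_filter_add_sum_filter_not P.support (fun α => α 0 % 2 = 0)]
  congr 2
  ext α
  simp

theorem I2_eq (z : V) : I2 z = z 0 ^ 2 + z 1 ^ 2 + z 2 ^ 2 + z 3 ^ 2 := by
  rw [I2, Fin.sum_univ_four]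

theorem Ioi_fin4 : Finset.Ioi (0 : Fin 4) = {1, 2, 3} ∧ Finset.Ioi (1 : Fin 4) = {2, 3} ∧
    Finset.Ioi (2 : Fin 4) = {3} ∧ Finset.Ioi (3 : Fin 4) = ∅ := by decide

theorem I4_eq (z : V) : I4 z = z 0 ^ 2 * z 1 ^ 2 + z 0 ^ 2 * z 2 ^ 2 + z 0 ^ 2 * z 3 ^ 2 +
    z 1 ^ 2 * z 2 ^ 2 + z 1 ^ 2 * z 3 ^ 2 + z 2 ^ 2 * z 3 ^ 2 := by
  obtain ⟨h0, h1, h2, h3⟩ := Ioi_fin4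
  simp [I4, Fin.sum_univ_four, h0, h1, h2, h3]
  ring

theorem I6_eq (z : V) : I6 z = z 0 ^ 2 * z 1 ^ 2 * z 2 ^ 2 + z 0 ^ 2 * z 1 ^ 2 * z 3 ^ 2 +
    z 0 ^ 2 * z 2 ^ 2 * z 3 ^ 2 + z 1 ^ 2 * z 2 ^ 2 * z 3 ^ 2 := by
  obtain ⟨h0, h1, h2, h3⟩ := Ioi_fin4
  simp [I6, Fin.sum_univ_four, h0, h1, h2, h3]

theorem I4tilde_eq (z : V) : I4tilde z = z 0 * z 1 * z 2 * z 3 := by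
  rw [I4tilde, Fin.prod_univ_four]

theorem eval_esymm_sq (z : V) :
    (fun i : Fin 4 => eval (z ^ 2) (esymm (Fin 4) ℂ (i + 1))) =
      ![I2 z, I4 z, I6 z, I4tilde z ^ 2] := by
  have h1 : Finset.powersetCard 1 (Finset.univ : Finset (Fin 4)) = {{0}, {1}, {2}, {3}} := by decide
  have h2 : Finset.powersetCard 2 (Finset.univ : Finset (Fin 4)) =
      {{0, 1}, {0, 2}, {0, 3}, {1, 2}, {1, 3}, {2, 3}} := by decide
  have h3 : Finset.powersetCard 3 (Finset.univ : Finset (Fin 4)) =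
      {{0, 1, 2}, {0, 1, 3}, {0, 2, 3}, {1, 2, 3}} := by decide
  have h4 : Finset.powersetCard 4 (Finset.univ : Finset (Fin 4)) = {{0, 1, 2, 3}} := by decide
  funext i
  fin_cases i
  · simp [esymm, h1, I2_eq]; ring
  · change eval (z ^ 2) (esymm (Fin 4) ℂ 2) = I4 z
    rw [esymm, h2, I4_eq]
    repeat rw [Finset.sum_insert (by decide)]
    simp
    ring
  · change eval (z ^ 2) (esymm (Fin 4) ℂ 3) = I6 z
    rw [esymm, h3, I6_eq]
    repeat rw [Finset.sum_insert (by decide)]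
    simp
    ring
  · change eval (z ^ 2) (esymm (Fin 4) ℂ 4) = I4tilde z ^ 2
    rw [esymm, h4, I4tilde_eq]
    simp
    ring

theorem exists_eval_esymm {A : MvPolynomial (Fin 4) ℂ} (hA : A.IsSymmetric) :
    ∃ Q : MvPolynomial (Fin 4) ℂ, ∀ z : V,
      eval (z ^ 2) A = eval ![I2 z, I4 z, I6 z, I4tilde z ^ 2] Q := by
  obtain ⟨Q, hQ⟩ := esymmAlgHom_surjective (σ := Fin 4) ℂ (n := 4) (by simp) ⟨A, hA⟩
  refine ⟨Q, fun z => ?_⟩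
  have h : A = aeval (fun i : Fin 4 => esymm (Fin 4) ℂ (i + 1)) Q := by
    rw [← esymmAlgHom_apply, hQ]
  rw [h, ← eval_esymm_sq]
  exact eval_bind₁ _ _ _

/-- The function of `z` that `N` is. -/
def N6 (z : V) : ℂ := I6 z / 4 - I2 z * I4 z / 24 + I2 z ^ 3 / 96

/-- A polynomial invariant under the signed transpositions is a polynomial in `I₂, T₁, T₂, N`. -/
theorem exists_eval_of_signedSwap {P : MvPolynomial (Fin 4) ℂ}
    (hP : ∀ i j, i ≠ j → ∀ ε z, eval (signedSwap i j ε z) P = eval z P) :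
    ∃ Q : MvPolynomial (Fin 4) ℂ, ∀ z : V, eval z P = eval ![I2 z, T1 z, T2 z, N6 z] Q := by
  have hs := isSymmetric_of_signedSwap hP
  obtain ⟨Q0, h0⟩ := exists_eval_esymm (parityPart_isSymmetric two_pos hs)
  obtain ⟨Q1, h1⟩ := exists_eval_esymm (parityPart_isSymmetric one_lt_two hs)
  -- `I₄`, `Ĩ₄`, `I₆` in terms of `I₂, T₁, T₂, N`
  let p4 : MvPolynomial (Fin 4) ℂ := C 6 * X 1 + C (1 / 4) * X 0 ^ 2
  let pt : MvPolynomial (Fin 4) ℂ := -(C 2 * X 2) - X 1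
  let p6 : MvPolynomial (Fin 4) ℂ := C 4 * X 3 + C (1 / 6) * X 0 * p4 - C (1 / 24) * X 0 ^ 3
  let g : Fin 4 → MvPolynomial (Fin 4) ℂ := ![X 0, p4, p6, pt ^ 2]
  have ht : ∀ z, eval ![I2 z, T1 z, T2 z, N6 z] pt = I4tilde z := by
    intro z; simp [pt, T1, T2]; ring
  have h4 : ∀ z, eval ![I2 z, T1 z, T2 z, N6 z] p4 = I4 z := by
    intro z; simp [p4, T1]; ring
  have h6 : ∀ z, eval ![I2 z, T1 z, T2 z, N6 z] p6 = I6 z := by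
    intro z; simp only [p6, map_sub, map_add, map_mul, h4]; simp [N6]; ring
  have hg : ∀ z Q, eval ![I2 z, T1 z, T2 z, N6 z] (bind₁ g Q) =
      eval ![I2 z, I4 z, I6 z, I4tilde z ^ 2] Q := by
    intro z Q
    rw [eval_bind₁]
    congr 2
    funext i
    fin_cases i
    · simp [g]
    · exact h4 z
    · exact h6 z
    · simp [g, ht]
  refine ⟨bind₁ g Q0 + pt * bind₁ g Q1, fun z => ?_⟩
  rw [eval_eq_parityPart (fun α hα => parity_of_signedSwap hP hα), h0, h1, map_add, map_mul, hg, hg,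
    ht]
  rfl

/-! ### Surjectivity of `(K, L, M, N)` at fixed `τ` -/

theorem exists_elementary_symmetric_eq (a b c d : ℂ) : ∃ r₀ r₁ r₂ r₃ : ℂ,
    r₀ + r₁ + r₂ + r₃ = a ∧ r₀ * r₁ + r₀ * r₂ + r₀ * r₃ + r₁ * r₂ + r₁ * r₃ + r₂ * r₃ = b ∧
    r₀ * r₁ * r₂ + r₀ * r₁ * r₃ + r₀ * r₂ * r₃ + r₁ * r₂ * r₃ = c ∧ r₀ * r₁ * r₂ * r₃ = d := by
  -- roots of `x⁴ - a x³ + b x² - c x + d`, split off one at a time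
  have root4 : ∃ x : ℂ, x ^ 4 - a * x ^ 3 + b * x ^ 2 - c * x + d = 0 := by
    obtain ⟨x, hx⟩ := IsAlgClosed.exists_root (Polynomial.X ^ 4 - Polynomial.C a * Polynomial.X ^ 3 +
      Polynomial.C b * Polynomial.X ^ 2 - Polynomial.C c * Polynomial.X + Polynomial.C d)
      (by
        have : (Polynomial.X ^ 4 - Polynomial.C a * Polynomial.X ^ 3 +
          Polynomial.C b * Polynomial.X ^ 2 - Polynomial.C c * Polynomial.X + Polynomial.C d :
          Polynomial ℂ).degree = 4 := by compute_degree!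
        rw [this]; norm_num)
    exact ⟨x, by simpa using hx⟩
  have root3 : ∀ a b c : ℂ, ∃ x : ℂ, x ^ 3 - a * x ^ 2 + b * x - c = 0 := by
    intro a b c
    obtain ⟨x, hx⟩ := IsAlgClosed.exists_root (Polynomial.X ^ 3 - Polynomial.C a * Polynomial.X ^ 2 +
      Polynomial.C b * Polynomial.X - Polynomial.C c)
      (by
        have : (Polynomial.X ^ 3 - Polynomial.C a * Polynomial.X ^ 2 +
          Polynomial.C b * Polynomial.X - Polynomial.C c : Polynomial ℂ).degree = 3 := by
          compute_degree!
        rw [this]; norm_num)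
    exact ⟨x, by simpa using hx⟩
  have root2 : ∀ a b : ℂ, ∃ x : ℂ, x ^ 2 - a * x + b = 0 := by
    intro a b
    obtain ⟨x, hx⟩ := IsAlgClosed.exists_root (Polynomial.X ^ 2 - Polynomial.C a * Polynomial.X +
      Polynomial.C b)
      (by
        have : (Polynomial.X ^ 2 - Polynomial.C a * Polynomial.X +
          Polynomial.C b : Polynomial ℂ).degree = 2 := by
          compute_degree!
        rw [this]; norm_num)
    exact ⟨x, by simpa using hx⟩
  obtain ⟨r₀, h0⟩ := root4
  obtain ⟨r₁, h1⟩ := root3 (a - r₀) (b - r₀ * (a - r₀)) (c - r₀ * (b - r₀ * (a - r₀)))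
  obtain ⟨r₂, h2⟩ := root2 (a - r₀ - r₁) (b - r₀ * (a - r₀) - r₁ * (a - r₀ - r₁))
  refine ⟨r₀, r₁, r₂, a - r₀ - r₁ - r₂, by ring, ?_, ?_, ?_⟩
  · linear_combination -h2
  · linear_combination (-r₀ - r₁) * h2 + h1
  · linear_combination (-r₀ * r₁) * h2 + r₀ * h1 - h0

theorem exists_basic_invariants_eq (a b c t : ℂ) :
    ∃ z : V, I2 z = a ∧ I4 z = b ∧ I6 z = c ∧ I4tilde z = t := by
  obtain ⟨r₀, r₁, r₂, r₃, h1, h2, h3, h4⟩ := exists_elementary_symmetric_eq a b c (t ^ 2)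
  obtain ⟨z₀, rfl⟩ := IsAlgClosed.exists_pow_nat_eq r₀ two_pos
  obtain ⟨z₁, rfl⟩ := IsAlgClosed.exists_pow_nat_eq r₁ two_pos
  obtain ⟨z₂, rfl⟩ := IsAlgClosed.exists_pow_nat_eq r₂ two_pos
  obtain ⟨z₃, rfl⟩ := IsAlgClosed.exists_pow_nat_eq r₃ two_pos
  have h5 : (z₀ * z₁ * z₂ * z₃) ^ 2 = t ^ 2 := by rw [← h4]; ring
  rcases sq_eq_sq_iff_eq_or_eq_neg.mp h5 with h | h
  · refine ⟨![z₀, z₁, z₂, z₃], ?_, ?_, ?_, ?_⟩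
    · simp [I2_eq, h1]
    · simp [I4_eq, h2]
    · simp [I6_eq, h3]
    · simp [I4tilde_eq, h]
  · refine ⟨![-z₀, z₁, z₂, z₃], ?_, ?_, ?_, ?_⟩
    · simp [I2_eq, h1]
    · simp [I4_eq, h2]
    · simp [I6_eq, h3]
    · simp [I4tilde_eq, h]

theorem T1_add_T2_add_T3 (z : V) : T1 z + T2 z + T3 z = 0 := by
  rw [T1, T2, T3]; ring

/-- Together with `diffProd_mul_T2`, Cramer's rule for `T₁, T₂` in terms of `L, M`. -/
theorem diffProd_mul_T1 (τ : ℍ) (z : V) :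
    diffProd τ * T1 z = -(e2 τ - e3 τ) * (e1 τ * L (τ, z) + 1 / 12 * M (τ, z)) := by
  have h3 : T3 z = -T1 z - T2 z := by linear_combination T1_add_T2_add_T3 z
  have he : e3 τ = -e1 τ - e2 τ := by linear_combination e1_add_e2_add_e3 τ
  simp only [diffProd, L, M, h3, he]
  ring

theorem diffProd_mul_T2 (τ : ℍ) (z : V) :
    diffProd τ * T2 z = (e1 τ - e3 τ) * (e2 τ * L (τ, z) + 1 / 12 * M (τ, z)) := by
  have h3 : T3 z = -T1 z - T2 z := by linear_combination T1_add_T2_add_T3 z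
  have he : e3 τ = -e1 τ - e2 τ := by linear_combination e1_add_e2_add_e3 τ
  simp only [diffProd, L, M, h3, he]
  ring

/-- The point `(K, L, M, N)(τ, z)` of `ℂ⁴`. -/
def klmn (τ : ℍ) (z : V) : V := ![K (τ, z), L (τ, z), M (τ, z), N (τ, z)]

/-- At fixed `τ` the map `z ↦ (K, L, M, N)` is onto `ℂ⁴`. -/
theorem klmn_surjective (τ : ℍ) : Function.Surjective (klmn τ) := by
  intro w
  have hD := diffProd_ne_zero τ
  let t1 : ℂ := -(e2 τ - e3 τ) * (e1 τ * w 1 + 1 / 12 * w 2) / diffProd τ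
  let t2 : ℂ := (e1 τ - e3 τ) * (e2 τ * w 1 + 1 / 12 * w 2) / diffProd τ
  have ht1 : diffProd τ * t1 = -(e2 τ - e3 τ) * (e1 τ * w 1 + 1 / 12 * w 2) := by
    simp only [t1]; field_simp
  have ht2 : diffProd τ * t2 = (e1 τ - e3 τ) * (e2 τ * w 1 + 1 / 12 * w 2) := by
    simp only [t2]; field_simp
  obtain ⟨z, h2, h4, h6, ht⟩ := exists_basic_invariants_eq (w 0) (6 * t1 + w 0 ^ 2 / 4)
    (4 * w 3 + w 0 * (6 * t1 + w 0 ^ 2 / 4) / 6 - w 0 ^ 3 / 24) (-2 * t2 - t1)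
  have hT1 : T1 z = t1 := by rw [T1, h4, h2]; ring
  have hT2 : T2 z = t2 := by rw [T2, h4, h2, ht]; ring
  have hT3 : T3 z = -t1 - t2 := by rw [← hT1, ← hT2]; linear_combination T1_add_T2_add_T3 z
  have he : e3 τ = -e1 τ - e2 τ := by linear_combination e1_add_e2_add_e3 τ
  refine ⟨z, ?_⟩
  funext i
  fin_cases i
  · exact h2
  · change L (τ, z) = w 1
    refine mul_left_cancel₀ hD ?_
    simp only [L, hT1, hT2, hT3]
    rw [show diffProd τ * (e1 τ * t1 + e2 τ * t2 + e3 τ * (-t1 - t2)) =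
      (e1 τ - e3 τ) * (diffProd τ * t1) + (e2 τ - e3 τ) * (diffProd τ * t2) by ring, ht1, ht2,
      diffProd]
    ring
  · change M (τ, z) = w 2
    refine mul_left_cancel₀ hD ?_
    simp only [M, hT1, hT2, hT3]
    rw [show diffProd τ * (12 * (e1 τ ^ 2 * t1 + e2 τ ^ 2 * t2 + e3 τ ^ 2 * (-t1 - t2))) =
      12 * ((e1 τ ^ 2 - e3 τ ^ 2) * (diffProd τ * t1) + (e2 τ ^ 2 - e3 τ ^ 2) * (diffProd τ * t2))
      by ring, ht1, ht2, diffProd, he]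
    ring
  · change N (τ, z) = w 3
    simp only [N, h2, h4, h6]
    ring

/-- Coefficients of a polynomial in `K, L, M, N` are determined by its values at a single `τ`. -/
theorem eq_of_eval_klmn {τ : ℍ} {P Q : MvPolynomial (Fin 4) ℂ}
    (h : ∀ z, eval (klmn τ z) P = eval (klmn τ z) Q) : P = Q := by
  refine MvPolynomial.funext fun w => ?_
  obtain ⟨z, rfl⟩ := klmn_surjective τ w
  exact h z

/-- Evaluation at `(K, L, M, N)` of a polynomial with coefficients in a ring `A` of functions
on `ℍ`. -/
def evalOver (A : Subalgebra ℂ (ℍ → ℂ)) : MvPolynomial (Fin 4) A →+* Fun :=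
  eval₂Hom (pullback.comp A.val.toRingHom) ![K, L, M, N]

/-- The value at `τ` of a polynomial with coefficients in a ring of functions on `ℍ`. -/
def atPoint (A : Subalgebra ℂ (ℍ → ℂ)) (τ : ℍ) :
    MvPolynomial (Fin 4) A →+* MvPolynomial (Fin 4) ℂ :=
  MvPolynomial.map ((Pi.evalRingHom (fun _ : ℍ => ℂ) τ).comp A.val.toRingHom)

theorem coeff_atPoint (A : Subalgebra ℂ (ℍ → ℂ)) (τ : ℍ) (p : MvPolynomial (Fin 4) A)
    (α : Fin 4 →₀ ℕ) : coeff α (atPoint A τ p) = ((coeff α p : A) : ℍ → ℂ) τ :=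
  coeff_map _ _ _

theorem evalOver_apply (A : Subalgebra ℂ (ℍ → ℂ)) (p : MvPolynomial (Fin 4) A) (τ : ℍ) (z : V) :
    evalOver A p (τ, z) = eval (klmn τ z) (atPoint A τ p) := by
  have : (Pi.evalRingHom (fun _ : ℍ × V => ℂ) (τ, z)).comp (evalOver A) =
      (eval (klmn τ z)).comp (atPoint A τ) := by
    refine MvPolynomial.ringHom_ext (fun a => ?_) (fun i => ?_)
    · simp [evalOver, atPoint, pullback]
    · fin_cases i <;> simp [evalOver, atPoint, klmn]
  exact RingHom.congr_fun this p

theorem evalOver_injective (A : Subalgebra ℂ (ℍ → ℂ)) : Function.Injective (evalOver A) := by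
  intro p q h
  refine MvPolynomial.ext _ _ fun α => ?_
  refine Subtype.ext (funext fun τ => ?_)
  rw [← coeff_atPoint, ← coeff_atPoint]
  congr 1
  refine eq_of_eval_klmn (τ := τ) fun z => ?_
  rw [← evalOver_apply, ← evalOver_apply, h]

/-! ### Modularity of `K, L, M, N` -/

theorem klmn_S (τ : ℍ) (z : V) :
    klmn (ModularGroup.S • τ) (wS z) = ![1, (τ : ℂ) ^ 2, (τ : ℂ) ^ 4, 1] * klmn τ z := by
  have h2 : I2 (wS z) = I2 z := by simp [I2_eq, wS_apply]; ring
  have h4 : T1 (wS z) = T3 z := by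
    simp [T1, T3, I2_eq, I4_eq, I4tilde_eq, wS_apply]; ring
  have h4' : T2 (wS z) = T2 z := by
    simp [T2, I2_eq, I4_eq, I4tilde_eq, wS_apply]; ring
  have h4'' : T3 (wS z) = T1 z := by
    simp [T1, T3, I2_eq, I4_eq, I4tilde_eq, wS_apply]; ring
  have h6 : I6 (wS z) / 4 - I2 (wS z) * I4 (wS z) / 24 + I2 (wS z) ^ 3 / 96 =
      I6 z / 4 - I2 z * I4 z / 24 + I2 z ^ 3 / 96 := by
    simp [I6_eq, I2_eq, I4_eq, wS_apply]; ring
  funext i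
  fin_cases i
  · simp [klmn, K, h2]
  · change L (ModularGroup.S • τ, wS z) = (τ : ℂ) ^ 2 * L (τ, z)
    simp only [L, h4, h4', h4'', e1_S, e2_S, e3_S]; ring
  · change M (ModularGroup.S • τ, wS z) = (τ : ℂ) ^ 4 * M (τ, z)
    simp only [M, h4, h4', h4'', e1_S, e2_S, e3_S]; ring
  · simp [klmn, N, h6]

theorem klmn_T (τ : ℍ) (z : V) : klmn (ModularGroup.T • τ) (wT z) = klmn τ z := by
  have h2 : I2 (wT z) = I2 z := by simp [I2_eq, wT_apply]
  have h4 : I4 (wT z) = I4 z := by simp [I4_eq, wT_apply]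
  have h6 : I6 (wT z) = I6 z := by simp [I6_eq, wT_apply]
  have ht : I4tilde (wT z) = -I4tilde z := by simp [I4tilde_eq, wT_apply]
  funext i
  fin_cases i
  · simp [klmn, K, h2]
  · change L (ModularGroup.T • τ, wT z) = L (τ, z)
    simp only [L, T1, T2, T3, h2, h4, ht, e1_T, e2_T, e3_T]; ring
  · change M (ModularGroup.T • τ, wT z) = M (τ, z)
    simp only [M, T1, T2, T3, h2, h4, ht, e1_T, e2_T, e3_T]; ring
  · simp [klmn, N, h2, h4, h6]

/-! ### Holomorphic functions with poles at the cusp -/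

theorem mdifferentiable_discriminant : MDiff ModularForm.discriminant :=
  CuspForm.discriminant.holo'

theorem isBoundedAtImInfty_discriminant : IsBoundedAtImInfty ModularForm.discriminant :=
  ModularForm.discriminant_isZeroAtImInfty.isBoundedAtImInfty

theorem isBoundedAtImInfty_mul {f g : ℍ → ℂ} (hf : IsBoundedAtImInfty f)
    (hg : IsBoundedAtImInfty g) : IsBoundedAtImInfty (f * g) :=
  (boundedAtImInftySubalgebra ℂ).mul_mem hf hg

theorem isBoundedAtImInfty_pow {f : ℍ → ℂ} (hf : IsBoundedAtImInfty f) (n : ℕ) :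
    IsBoundedAtImInfty (f ^ n) :=
  (boundedAtImInftySubalgebra ℂ).pow_mem hf n

theorem isBoundedAtImInfty_of_tendsto {f : ℍ → ℂ} {l : ℂ} (h : Tendsto f atImInfty (𝓝 l)) :
    IsBoundedAtImInfty f :=
  h.isBigO_one ℝ

/-- The holomorphic functions on `ℍ` that become bounded at `i∞` after multiplication by a power
of `Δ`. -/
def tameRing : Subalgebra ℂ (ℍ → ℂ) where
  carrier := {f | MDiff f ∧ ∃ n : ℕ, IsBoundedAtImInfty (ModularForm.discriminant ^ n * f)}
  mul_mem' := by
    rintro f g ⟨hf, n, hn⟩ ⟨hg, m, hm⟩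
    refine ⟨hf.mul hg, n + m, ?_⟩
    rw [pow_add, mul_mul_mul_comm]
    exact isBoundedAtImInfty_mul hn hm
  add_mem' := by
    rintro f g ⟨hf, n, hn⟩ ⟨hg, m, hm⟩
    refine ⟨hf.add hg, n + m, ?_⟩
    have h := (boundedAtImInftySubalgebra ℂ).add_mem
      (isBoundedAtImInfty_mul (isBoundedAtImInfty_pow isBoundedAtImInfty_discriminant m) hn)
      (isBoundedAtImInfty_mul (isBoundedAtImInfty_pow isBoundedAtImInfty_discriminant n) hm)
    have h' : ModularForm.discriminant ^ (n + m) * (f + g) =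
        ModularForm.discriminant ^ m * (ModularForm.discriminant ^ n * f) +
          ModularForm.discriminant ^ n * (ModularForm.discriminant ^ m * g) := by
      rw [pow_add]; ring
    rw [h']
    exact h
  algebraMap_mem' c := by
    refine ⟨mdifferentiable_const, 0, ?_⟩
    rw [pow_zero, one_mul]
    exact (boundedAtImInftySubalgebra ℂ).algebraMap_mem c

theorem mem_tameRing_of_bounded {f : ℍ → ℂ} (hf : MDiff f) (hb : IsBoundedAtImInfty f) :
    f ∈ tameRing :=
  ⟨hf, 0, by rwa [pow_zero, one_mul]⟩

theorem inv_discriminant_mem_tameRing : (ModularForm.discriminant)⁻¹ ∈ tameRing := by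
  refine ⟨?_, 1, ?_⟩
  · have := (mdifferentiable_const (c := (1 : ℂ))).div mdifferentiable_discriminant
      ModularForm.discriminant_ne_zero
    have h : (ModularForm.discriminant)⁻¹ = fun τ => 1 / ModularForm.discriminant τ := by
      funext τ; simp
    rw [h]
    exact this
  · have : ModularForm.discriminant ^ 1 * (ModularForm.discriminant)⁻¹ = 1 := by
      funext τ
      simp [ModularForm.discriminant_ne_zero τ]
    rw [this]
    exact (boundedAtImInftySubalgebra ℂ).one_mem

theorem e1_mem_tameRing : e1 ∈ tameRing :=
  mem_tameRing_of_bounded mdifferentiable_e1 (isBoundedAtImInfty_of_tendsto tendsto_e1)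

theorem e2_mem_tameRing : e2 ∈ tameRing :=
  mem_tameRing_of_bounded mdifferentiable_e2 (isBoundedAtImInfty_of_tendsto tendsto_e2)

theorem e3_mem_tameRing : e3 ∈ tameRing :=
  mem_tameRing_of_bounded mdifferentiable_e3 (isBoundedAtImInfty_of_tendsto tendsto_e3)

theorem inv_diffProd_mem_tameRing : diffProd⁻¹ ∈ tameRing := by
  obtain ⟨c, hc, h⟩ := exists_diffProd_sq
  have h1 : diffProd ∈ tameRing :=
    tameRing.mul_mem (tameRing.mul_mem (tameRing.sub_mem e1_mem_tameRing e3_mem_tameRing)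
      (tameRing.sub_mem e2_mem_tameRing e3_mem_tameRing))
      (tameRing.sub_mem e2_mem_tameRing e1_mem_tameRing)
  -- `1 / D = D / (c Δ)`
  have h2 : diffProd⁻¹ = c⁻¹ • (diffProd * (ModularForm.discriminant)⁻¹) := by
    funext τ
    have hD := diffProd_ne_zero τ
    have hΔ := ModularForm.discriminant_ne_zero τ
    simp only [Pi.inv_apply, Pi.smul_apply, Pi.mul_apply, smul_eq_mul]
    field_simp
    linear_combination -(h τ)
  rw [h2]
  exact tameRing.smul_mem (tameRing.mul_mem h1 inv_discriminant_mem_tameRing) _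

/-- A function on `ℍ` that is holomorphic, has at most a pole at the cusp, and transforms with an
integer weight under both generators of `SL₂(ℤ)` is a modular form divided by a power of `Δ`. -/
theorem mem_modularFormRingInvDelta {f : ℍ → ℂ} {k : ℤ} (hf : f ∈ tameRing)
    (hT : ∀ τ, f (ModularGroup.T • τ) = f τ)
    (hS : ∀ τ : ℍ, f (ModularGroup.S • τ) = (τ : ℂ) ^ k * f τ) : f ∈ modularFormRingInvDelta := by
  obtain ⟨hol, n, hn⟩ := hf
  -- a power of `Δ` that cancels the pole and makes the weight nonnegative
  let m : ℕ := n + k.natAbs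
  obtain ⟨w, hw⟩ : ∃ w : ℕ, (w : ℤ) = k + 12 * m := ⟨(k + 12 * m).toNat, by omega⟩
  have hΔT : ∀ τ, ModularForm.discriminant (ModularGroup.T • τ) = ModularForm.discriminant τ := by
    intro τ
    have := (ModularForm.slash_action_eq'_iff 12 _ _ τ).mp
      (congrFun ModularForm.discriminant_T_invariant τ)
    simpa [ModularGroup.T] using this
  have hΔS : ∀ τ : ℍ, ModularForm.discriminant (ModularGroup.S • τ) =
      (τ : ℂ) ^ 12 * ModularForm.discriminant τ := by
    intro τ
    have := (ModularForm.slash_action_eq'_iff 12 _ _ τ).mp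
      (congrFun ModularForm.discriminant_S_invariant τ)
    rw [this]
    simp [ModularGroup.S]
  obtain ⟨F, hF⟩ := exists_modularForm_of_generators (k := (w : ℤ))
    (f := ModularForm.discriminant ^ m * f) ((mdifferentiable_discriminant.pow m).mul hol)
    (by
      have : ModularForm.discriminant ^ m * f =
          ModularForm.discriminant ^ k.natAbs * (ModularForm.discriminant ^ n * f) := by
        simp only [m, pow_add]; ring
      rw [this]
      exact isBoundedAtImInfty_mul (isBoundedAtImInfty_pow isBoundedAtImInfty_discriminant _) hn)
    (fun τ => by simp only [Pi.mul_apply, Pi.pow_apply, hΔT, hT])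
    (fun τ => by
      simp only [Pi.mul_apply, Pi.pow_apply, hΔS, hS]
      rw [hw, zpow_add₀ τ.ne_zero, zpow_mul, zpow_natCast, mul_pow]
      rw [show ((τ : ℂ) ^ (12 : ℤ)) = (τ : ℂ) ^ 12 by norm_cast]
      ring)
  have h : f = ⇑F * (fun τ => (ModularForm.discriminant τ)⁻¹) ^ m := by
    funext τ
    have := ModularForm.discriminant_ne_zero τ
    rw [hF]
    simp only [Pi.mul_apply, Pi.pow_apply, inv_pow]
    field_simp
  rw [h]
  refine modularFormRingInvDelta.mul_mem (Algebra.subset_adjoin (Or.inl ?_))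
    (modularFormRingInvDelta.pow_mem (Algebra.subset_adjoin (Or.inr rfl)) m)
  exact Algebra.subset_adjoin ⟨w, F, rfl⟩

/-! ### Coordinates on finite-dimensional spaces of functions -/

/-- The coordinates on a finite-dimensional space of functions are combinations of evaluations. -/
theorem exists_eval_coordinates {X : Type*} (U : Submodule ℂ (X → ℂ)) [FiniteDimensional ℂ U] :
    ∃ (n : ℕ) (u : Fin n → X → ℂ) (c : Fin n → X →₀ ℂ), (∀ i, u i ∈ U) ∧
      ∀ f ∈ U, f = ∑ i, ((c i).sum fun x a => a * f x) • u i := by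
  let b := Module.finBasis ℂ U
  let u : Fin (Module.finrank ℂ U) → X → ℂ := fun i => b i
  have hli : LinearIndependent ℂ u := b.linearIndependent.map' U.subtype U.ker_subtype
  have hsp := span_flip_eq_top_iff_linearIndependent.mpr hli
  have hc : ∀ i, ∃ c : X →₀ ℂ, (c.sum fun x a => a • flip u x) = Pi.single i 1 := fun i =>
    Finsupp.mem_span_range_iff_exists_finsupp.mp (hsp ▸ Submodule.mem_top)
  choose c hc using hc
  refine ⟨_, u, c, fun i => (b i).2, fun f hf => ?_⟩
  have hrep : f = ∑ i, b.repr ⟨f, hf⟩ i • u i := by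
    have := congrArg U.subtype (b.sum_repr ⟨f, hf⟩)
    rw [map_sum] at this
    exact this.symm
  have hcoord : ∀ i, ((c i).sum fun x a => a * f x) = b.repr ⟨f, hf⟩ i := by
    intro i
    calc ((c i).sum fun x a => a * f x)
        = (c i).sum fun x a => ∑ j, b.repr ⟨f, hf⟩ j * (a • flip u x) j := by
          refine Finsupp.sum_congr fun x _ => ?_
          conv_lhs => rw [hrep]
          rw [Finset.sum_apply, Finset.mul_sum]
          refine Finset.sum_congr rfl fun j _ => ?_
          simp only [Pi.smul_apply, smul_eq_mul, flip]
          ring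
      _ = ∑ j, b.repr ⟨f, hf⟩ j * ((c i).sum fun x a => a • flip u x) j := by
          simp only [Finsupp.sum]
          rw [Finset.sum_comm]
          refine Finset.sum_congr rfl fun j _ => ?_
          rw [Finset.sum_apply, Finset.mul_sum]
      _ = b.repr ⟨f, hf⟩ i := by
          rw [hc i]
          simp [Pi.single_apply]
  simp only [hcoord]
  exact hrep

/-! ### Analytic behaviour of triality invariants in `τ` -/

variable {k : ℤ} {m : ℕ} {φ : Fun}

theorem IsTrialityInvariant.apply_signedSwap (hφ : IsTrialityInvariant k m φ) {i j : Fin 4}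
    (hij : i ≠ j) (ε : ℤˣ) (τ : ℍ) (z : V) : φ (τ, signedSwap i j ε z) = φ (τ, z) := by
  have := hφ.transform _ (signedSwap_mem_trialityGroup hij ε) τ z
  simpa using this

theorem IsTrialityInvariant.mdifferentiable (hφ : IsTrialityInvariant k m φ) (z : V) :
    MDiff (fun τ : ℍ => φ (τ, z)) := by
  rw [UpperHalfPlane.mdifferentiable_iff]
  exact hφ.holomorphic.comp (g := fun p : ℂ × V => φ (ofComplex p.1, p.2))
    (f := fun w : ℂ => (w, z)) (by fun_prop) (fun w hw => ⟨hw, trivial⟩)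

theorem exists_polynomial_last_coordinate {P : MvPolynomial (Fin 4) ℂ} (hP : P.IsHomogeneous m)
    (z₁ z₂ z₃ s : ℂ) :
    ∃ p : Polynomial ℂ, p.natDegree ≤ m ∧ ∀ y, p.eval y = eval ![z₁, z₂, z₃, s * y] P := by
  refine ⟨aeval ![Polynomial.C z₁, Polynomial.C z₂, Polynomial.C z₃,
    Polynomial.C s * Polynomial.X] P, ?_, fun y => ?_⟩
  · have := aeval_natDegree_le (m := m) (n := 1) P hP.totalDegree_le
      ![Polynomial.C z₁, Polynomial.C z₂, Polynomial.C z₃, Polynomial.C s * Polynomial.X]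
      (fun i => by
        fin_cases i
        · simp
        · simp
        · simp
        · exact (Polynomial.natDegree_C_mul_le _ _).trans Polynomial.natDegree_X_le)
    simpa using this
  · have : (Polynomial.evalRingHom y).comp (aeval ![Polynomial.C z₁, Polynomial.C z₂,
        Polynomial.C z₃, Polynomial.C s * Polynomial.X] :
        MvPolynomial (Fin 4) ℂ →ₐ[ℂ] Polynomial ℂ).toRingHom = eval ![z₁, z₂, z₃, s * y] := by
      refine MvPolynomial.ringHom_ext (fun a => ?_) (fun i => ?_)
      · simp
      · fin_cases i <;> simp
    exact RingHom.congr_fun this P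

theorem isBoundedAtImInfty_of_tendsto_norm {f : ℍ → ℂ} {l : ℝ}
    (h : Tendsto (fun τ => ‖f τ‖) atImInfty (𝓝 l)) : IsBoundedAtImInfty f :=
  (h.isBigO_one ℝ).of_norm_left

/-- The cusp condition bounds `φ(τ, z₁, z₂, z₃, q^{-1/2} Λ)` for `m + 1` values of `Λ`; since `φ` has
degree at most `m` in `z₄`, Lagrange interpolation bounds it at each fixed `z`, which is the value
at `Λ = q^{1/2} z₄ → 0`. -/
theorem IsTrialityInvariant.isBoundedAtImInfty (hφ : IsTrialityInvariant k m φ) (z : V) :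
    IsBoundedAtImInfty (fun τ : ℍ => φ (τ, z)) := by
  let v : ℕ → ℂ := fun j => (j : ℂ) + 1
  let s : ℍ → ℂ := fun τ => cexp (-(Real.pi * Complex.I * τ))
  have hv : Set.InjOn v (Finset.range (m + 1)) := by
    intro i _ j _ h
    simpa [v] using h
  have hv0 : ∀ j, v j ≠ 0 := fun j => Nat.cast_add_one_ne_zero j
  have hs0 : ∀ τ, s τ ≠ 0 := fun τ => Complex.exp_ne_zero _
  have hs : Tendsto (fun τ => z 3 / s τ) atImInfty (𝓝 0) := by
    have h : Tendsto (fun τ : ℍ => (s τ)⁻¹) atImInfty (𝓝 0) := by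
      rw [tendsto_zero_iff_norm_tendsto_zero]
      have him : Tendsto (fun τ : ℍ => τ.im) atImInfty atTop := tendsto_comap
      refine (Real.tendsto_exp_atBot.comp
        (him.const_mul_atTop_of_neg (neg_lt_zero.mpr Real.pi_pos))).congr fun τ => ?_
      simp [s, Complex.norm_exp, ← Real.exp_neg]
    simpa [div_eq_mul_inv] using h.const_mul (z 3)
  have key : ∀ τ, φ (τ, z) = ∑ j ∈ Finset.range (m + 1), φ (τ, ![z 0, z 1, z 2, s τ * v j]) *
      (Lagrange.basis (Finset.range (m + 1)) v j).eval (z 3 / s τ) := by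
    intro τ
    obtain ⟨P, hP, hPφ⟩ := hφ.homogeneous τ
    obtain ⟨p, hp, hpP⟩ := exists_polynomial_last_coordinate hP (z 0) (z 1) (z 2) (s τ)
    have hz : z = ![z 0, z 1, z 2, s τ * (z 3 / s τ)] := by
      rw [mul_div_cancel₀ _ (hs0 τ)]
      funext i; fin_cases i <;> rfl
    have hint := Lagrange.eq_interpolate (f := p) hv (by
      rw [Finset.card_range]
      exact lt_of_le_of_lt (Polynomial.degree_le_of_natDegree_le hp) (by exact_mod_cast m.lt_succ_self))
    have hval : φ (τ, z) = p.eval (z 3 / s τ) := by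
      rw [hpP, ← hPφ, ← hz]
    rw [hval]
    conv_lhs => rw [hint]
    rw [Lagrange.interpolate_apply, Polynomial.eval_finsetSum]
    refine Finset.sum_congr rfl fun j _ => ?_
    rw [Polynomial.eval_mul, Polynomial.eval_C, hpP, hPφ]
  have hfun : (fun τ : ℍ => φ (τ, z)) = ∑ j ∈ Finset.range (m + 1),
      (fun τ : ℍ => φ (τ, ![z 0, z 1, z 2, s τ * v j])) *
      (fun τ : ℍ => (Lagrange.basis (Finset.range (m + 1)) v j).eval (z 3 / s τ)) := by
    funext τ
    rw [key, Finset.sum_apply]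
    rfl
  rw [hfun]
  refine (boundedAtImInftySubalgebra ℂ).sum_mem fun j _ => ?_
  refine (boundedAtImInftySubalgebra ℂ).mul_mem ?_ ?_
  · obtain ⟨l, hl⟩ := hφ.cusp (z 0) (z 1) (z 2) (v j) (hv0 j)
    exact isBoundedAtImInfty_of_tendsto_norm hl
  · exact isBoundedAtImInfty_of_tendsto
      (((Lagrange.basis (Finset.range (m + 1)) v j).continuous.tendsto 0).comp hs)

theorem IsTrialityInvariant.apply_mem_tameRing (hφ : IsTrialityInvariant k m φ) (z : V) :
    (fun τ : ℍ => φ (τ, z)) ∈ tameRing :=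
  mem_tameRing_of_bounded (hφ.mdifferentiable z) (hφ.isBoundedAtImInfty z)

/-! ### Expansion of triality invariants in `K, L, M, N` -/

theorem pullback_mem_range {f : ℍ → ℂ} (hf : f ∈ tameRing) :
    pullback f ∈ (evalOver tameRing).rangeS :=
  ⟨C ⟨f, hf⟩, by simp [evalOver]⟩

theorem K_mem_range : K ∈ (evalOver tameRing).rangeS := ⟨X 0, by simp [evalOver]⟩

theorem L_mem_range : L ∈ (evalOver tameRing).rangeS := ⟨X 1, by simp [evalOver]⟩

theorem M_mem_range : M ∈ (evalOver tameRing).rangeS := ⟨X 2, by simp [evalOver]⟩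

theorem N_mem_range : N ∈ (evalOver tameRing).rangeS := ⟨X 3, by simp [evalOver]⟩

theorem T1_mem_range : (fun p => T1 p.2 : Fun) ∈ (evalOver tameRing).rangeS := by
  have h : (fun p => T1 p.2 : Fun) = pullback (-(diffProd⁻¹ * (e2 - e3) * e1)) * L +
      pullback (-((1 / 12 : ℂ) • (diffProd⁻¹ * (e2 - e3)))) * M := by
    funext ⟨τ, z⟩
    refine mul_left_cancel₀ (diffProd_ne_zero τ) ?_
    have := diffProd_ne_zero τ
    simp only [diffProd_mul_T1, pullback, RingHom.coe_mk, MonoidHom.coe_mk, OneHom.coe_mk,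
      Pi.add_apply, Pi.mul_apply, Pi.neg_apply, Pi.sub_apply, Pi.inv_apply, Pi.smul_apply,
      smul_eq_mul]
    field_simp
    ring
  have hb := tameRing.mul_mem inv_diffProd_mem_tameRing
    (tameRing.sub_mem e2_mem_tameRing e3_mem_tameRing)
  rw [h]
  exact Subsemiring.add_mem _
    (Subsemiring.mul_mem _ (pullback_mem_range (tameRing.neg_mem (tameRing.mul_mem hb e1_mem_tameRing)))
      L_mem_range)
    (Subsemiring.mul_mem _ (pullback_mem_range (tameRing.neg_mem (tameRing.smul_mem hb _))) M_mem_range)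

theorem T2_mem_range : (fun p => T2 p.2 : Fun) ∈ (evalOver tameRing).rangeS := by
  have h : (fun p => T2 p.2 : Fun) = pullback (diffProd⁻¹ * (e1 - e3) * e2) * L +
      pullback ((1 / 12 : ℂ) • (diffProd⁻¹ * (e1 - e3))) * M := by
    funext ⟨τ, z⟩
    refine mul_left_cancel₀ (diffProd_ne_zero τ) ?_
    have := diffProd_ne_zero τ
    simp only [diffProd_mul_T2, pullback, RingHom.coe_mk, MonoidHom.coe_mk, OneHom.coe_mk,
      Pi.add_apply, Pi.mul_apply, Pi.sub_apply, Pi.inv_apply, Pi.smul_apply, smul_eq_mul]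
    field_simp
  have hb := tameRing.mul_mem inv_diffProd_mem_tameRing
    (tameRing.sub_mem e1_mem_tameRing e3_mem_tameRing)
  rw [h]
  exact Subsemiring.add_mem _
    (Subsemiring.mul_mem _ (pullback_mem_range (tameRing.mul_mem hb e2_mem_tameRing)) L_mem_range)
    (Subsemiring.mul_mem _ (pullback_mem_range (tameRing.smul_mem hb _)) M_mem_range)

theorem eval_mem_range (Q : MvPolynomial (Fin 4) ℂ) :
    (fun p => eval ![I2 p.2, T1 p.2, T2 p.2, N6 p.2] Q : Fun) ∈ (evalOver tameRing).rangeS := by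
  induction Q using MvPolynomial.induction_on with
  | C a =>
    simp only [eval_C]
    exact pullback_mem_range (tameRing.algebraMap_mem a)
  | add P Q hP hQ =>
    simp only [map_add]
    exact Subsemiring.add_mem _ hP hQ
  | mul_X P i hP =>
    simp only [map_mul, eval_X]
    refine Subsemiring.mul_mem _ hP ?_
    fin_cases i
    · exact K_mem_range
    · exact T1_mem_range
    · exact T2_mem_range
    · exact N_mem_range

/-- The functions of `z` given by polynomials of degree at most `m` that are invariant under the
signed transpositions. -/
def invariantFunctions (m : ℕ) : Submodule ℂ (V → ℂ) where
  carrier := {f | (∃ P ∈ restrictTotalDegree (Fin 4) ℂ m, f = fun z => eval z P) ∧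
    ∀ i j, i ≠ j → ∀ ε z, f (signedSwap i j ε z) = f z}
  zero_mem' := ⟨⟨0, Submodule.zero_mem _, by simp; rfl⟩, fun _ _ _ _ _ => rfl⟩
  add_mem' := by
    rintro _ _ ⟨⟨P, hP, rfl⟩, hf⟩ ⟨⟨Q, hQ, rfl⟩, hg⟩
    refine ⟨⟨P + Q, Submodule.add_mem _ hP hQ, by funext z; simp⟩, fun i j hij ε z => ?_⟩
    exact congrArg₂ (· + ·) (hf i j hij ε z) (hg i j hij ε z)
  smul_mem' := by
    rintro c _ ⟨⟨P, hP, rfl⟩, hf⟩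
    refine ⟨⟨c • P, Submodule.smul_mem _ c hP, by funext z; simp⟩, fun i j hij ε z => ?_⟩
    exact congrArg (c • ·) (hf i j hij ε z)

/-- Polynomials as functions. -/
def evalFunction : MvPolynomial (Fin 4) ℂ →ₗ[ℂ] (V → ℂ) where
  toFun P z := eval z P
  map_add' P Q := by funext z; simp
  map_smul' c P := by funext z; simp

instance (m : ℕ) : FiniteDimensional ℂ (invariantFunctions m) := by
  have h : invariantFunctions m ≤ (restrictTotalDegree (Fin 4) ℂ m).map evalFunction := by
    rintro f ⟨⟨P, hP, rfl⟩, -⟩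
    exact ⟨P, hP, rfl⟩
  exact Submodule.finiteDimensional_of_le h

/-- A triality invariant is a polynomial in `K, L, M, N` whose coefficients are holomorphic on `ℍ` with
at most a pole at the cusp. -/
theorem IsTrialityInvariant.mem_range_evalOver (hφ : IsTrialityInvariant k m φ) :
    φ ∈ (evalOver tameRing).rangeS := by
  obtain ⟨n, u, c, hu, hc⟩ := exists_eval_coordinates (invariantFunctions m)
  have hφU : ∀ τ, (fun z => φ (τ, z)) ∈ invariantFunctions m := by
    intro τ
    obtain ⟨P, hP, hPφ⟩ := hφ.homogeneous τ
    refine ⟨⟨P, ?_, funext hPφ⟩, fun i j hij ε z => hφ.apply_signedSwap hij ε τ z⟩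
    exact (mem_restrictTotalDegree _ _ _).mpr hP.totalDegree_le
  have huQ : ∀ i, ∃ Q : MvPolynomial (Fin 4) ℂ, ∀ z, u i z = eval ![I2 z, T1 z, T2 z, N6 z] Q := by
    intro i
    obtain ⟨⟨P, -, hP⟩, hinv⟩ := hu i
    rw [hP] at hinv ⊢
    exact exists_eval_of_signedSwap hinv
  choose Q hQ using huQ
  have hexp : φ = ∑ i, pullback (fun τ => (c i).sum fun x a => a * φ (τ, x)) *
      (fun p => eval ![I2 p.2, T1 p.2, T2 p.2, N6 p.2] (Q i) : Fun) := by
    funext ⟨τ, z⟩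
    have := congrFun (hc _ (hφU τ)) z
    simp only [Finset.sum_apply, Pi.smul_apply, smul_eq_mul, hQ] at this
    rw [this, Finset.sum_apply]
    rfl
  rw [hexp]
  refine Subsemiring.sum_mem _ fun i _ => Subsemiring.mul_mem _ (pullback_mem_range ?_) (eval_mem_range _)
  have : (fun τ => (c i).sum fun x a => a * φ (τ, x)) =
      ∑ x ∈ (c i).support, c i x • (fun τ : ℍ => φ (τ, x)) := by
    funext τ
    rw [Finset.sum_apply]
    rfl
  rw [this]
  exact tameRing.sum_mem fun x _ => tameRing.smul_mem (hφ.apply_mem_tameRing x) _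

theorem evalKLMN_eq : evalKLMN = evalOver modularFormRingInvDelta := rfl

/-- By uniqueness of the expansion in `K, L, M, N`, the coefficient of `K^a L^b M^c N^d` in a
triality invariant of weight `k` is modular of weight `k - 2b - 4c`. -/
theorem IsTrialityInvariant.exists_evalKLMN (hφ : IsTrialityInvariant k m φ) :
    ∃ p, evalKLMN p = φ := by
  obtain ⟨p, hp⟩ := hφ.mem_range_evalOver
  have hT : ∀ τ, atPoint tameRing (ModularGroup.T • τ) p = atPoint tameRing τ p := by
    intro τ
    refine eq_of_eval_klmn (τ := τ) fun z => ?_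
    rw [← evalOver_apply, ← klmn_T, ← evalOver_apply, hp]
    simpa [ModularGroup.T] using hφ.transform _ T_mem_trialityGroup τ z
  have hS : ∀ τ : ℍ, scaleVars ![1, (τ : ℂ) ^ 2, (τ : ℂ) ^ 4, 1]
      (atPoint tameRing (ModularGroup.S • τ) p) = C ((τ : ℂ) ^ k) * atPoint tameRing τ p := by
    intro τ
    refine eq_of_eval_klmn (τ := τ) fun z => ?_
    rw [eval_scaleVars, ← klmn_S, ← evalOver_apply, map_mul, eval_C, ← evalOver_apply, hp]
    simpa [ModularGroup.S] using hφ.transform _ S_mem_trialityGroup τ z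
  have hcoeff : ∀ α, ((coeff α p : tameRing) : ℍ → ℂ) ∈ modularFormRingInvDelta := by
    intro α
    refine mem_modularFormRingInvDelta (k := k - 2 * α 1 - 4 * α 2) (coeff α p).2
      (fun τ => ?_) (fun τ => ?_)
    · rw [← coeff_atPoint, hT, coeff_atPoint]
    · have h := congrArg (coeff α) (hS τ)
      rw [coeff_scaleVars, coeff_C_mul, coeff_atPoint, coeff_atPoint, Fin.prod_univ_four] at h
      have h0 : (τ : ℂ) ≠ 0 := τ.ne_zero
      have hprod : (τ : ℂ) ^ (k - 2 * α 1 - 4 * α 2) * ((τ : ℂ) ^ (2 * α 1) * (τ : ℂ) ^ (4 * α 2)) =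
          (τ : ℂ) ^ k := by
        rw [← zpow_natCast, ← zpow_natCast, ← zpow_add₀ h0, ← zpow_add₀ h0]
        congr 1
        push_cast
        ring
      refine mul_left_cancel₀ (mul_ne_zero (pow_ne_zero (2 * α 1) h0) (pow_ne_zero (4 * α 2) h0)) ?_
      rw [← mul_assoc, mul_comm _ ((τ : ℂ) ^ (k - 2 * α 1 - 4 * α 2)), hprod, ← h]
      simp [pow_mul]
  obtain ⟨p', hp'⟩ : MvPolynomial.map tameRing.val.toRingHom p ∈
      Set.range (MvPolynomial.map modularFormRingInvDelta.val.toRingHom) := by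
    rw [mem_range_map_iff_coeffs_subset]
    intro f hf
    obtain ⟨α, -, rfl⟩ := mem_coeffs_iff.mp hf
    rw [coeff_map]
    exact ⟨⟨_, hcoeff α⟩, rfl⟩
  refine ⟨p', ?_⟩
  rw [evalKLMN_eq, ← hp]
  funext ⟨τ, z⟩
  rw [evalOver_apply, evalOver_apply, atPoint, atPoint, ← MvPolynomial.map_map, hp',
    MvPolynomial.map_map]

end D4Triality

end

theorem mainTheorem8 :
    Function.Injective D4Triality.evalKLMN ∧
      ∀ φ ∈ D4Triality.trialityRing,
        ∃ p : MvPolynomial (Fin 4) D4Triality.modularFormRingInvDelta,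
          D4Triality.evalKLMN p = φ := by
  refine ⟨D4Triality.evalOver_injective _, fun φ hφ => ?_⟩
  change φ ∈ Submodule.span ℂ _ at hφ
  induction hφ using Submodule.span_induction with
  | mem φ h =>
    obtain ⟨k, m, h⟩ := h
    exact h.exists_evalKLMN
  | zero => exact ⟨0, map_zero _⟩
  | add φ ψ _ _ hφ hψ =>
    obtain ⟨p, rfl⟩ := hφ
    obtain ⟨q, rfl⟩ := hψ
    exact ⟨p + q, map_add _ _ _⟩
  | smul c φ _ hφ =>
    obtain ⟨p, rfl⟩ := hφ
    refine ⟨MvPolynomial.C (algebraMap ℂ _ c) * p, ?_⟩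
    rw [map_mul]
    congr 1
    simp [D4Triality.evalKLMN]
    rfl
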